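/- Let $2\le k\le n$ be integers. For a real symmetric $n\times n$ matrix $A$ let $\sigma_m(A)$ be the $m$-th elementary symmetric function of its eigenvalues ($\sigma_0(A)=1$), and write $A\in\Gamma_m$ if $\sigma_1(A)>0,\dots,\sigma_m(A)>0$. Let $\Omega\subset\mathbb R^n$ be a bounded domain with smooth boundary and put $\|f\|_{C^{1,1}(\Omega)}=\sup_\Omega|f|+\sup_\Omega|Df|+\mathrm{Lip}_\Omega(Df)$. For every $K\ge 0$ there is a constant $C$, depending only on $n,k,\Omega$ and $K$, with the following property. Let $\alpha$ and $\alpha_0,\dots,\alpha_{k-2}$ be real functions on $\Omega$ with $\alpha_\ell\ge0$, $\alpha\in C^{1,1}(\Omega)$, $\alpha_\ell^{1/(k-\ell)}\in C^{1,1}(\Omega)$, and $$\|\alpha\|_{C^{1,1}(\Omega)}\le K,\qquad \|\alpha_\ell^{1/(k-\ell)}\|_{C^{1,1}(\Omega)}\le K\quad(0\le\ell\le k-2)$$ (no sign is assumed on $\alpha$, and no positive lower bound on the $\alpha_\ell$). Let $u\in C^4(\Omega)\cap C^2(\bar\Omega)$ satisfy $D^2u(x)\in\Gamma_{k-1}$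 and $$\sigma_k(D^2u)+\alpha(x)\,\sigma_{k-1}(D^2u)=\sum_{\ell=0}^{k-2}\alpha_\ell(x)\,\sigma_\ell(D^2u)$$ for all $x\in\Omega$. Then $$\sup_\Omega|D^2u|\le C\Bigl(1+\sup_{\partial\Omega}|D^2u|\Bigr),$$ where $|A|=(\sum_{i,j}A_{ij}^2)^{1/2}$, and $D^2u$ on $\partial\Omega$ is the continuous extension of $D^2u$ from $\Omega$. -/

import Mathlib

open scoped NNReal ENNReal ContDiff Topology

noncomputable section

namespace HessianEquation

variable {n : ℕ}

/-- The Euclidean space `ℝⁿ`. -/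
abbrev E (n : ℕ) : Type := EuclideanSpace ℝ (Fin n)

/-- The `i`-th vector of the standard basis of `ℝⁿ`. -/
def stdVec (i : Fin n) : E n := EuclideanSpace.single i (1 : ℝ)

/-- The Hessian matrix `D²u(x) = (uᵢⱼ(x))`. -/
def hessian (u : E n → ℝ) (x : E n) : Matrix (Fin n) (Fin n) ℝ :=
  Matrix.of fun i j => fderiv ℝ (fderiv ℝ u) x (stdVec i) (stdVec j)

/-- The (Frobenius) norm `|A| = (∑ᵢⱼ Aᵢⱼ²)^{1/2}`. -/
def matrixNorm (A : Matrix (Fin n) (Fin n) ℝ) : ℝ :=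
  Real.sqrt (∑ i, ∑ j, A i j ^ 2)

/-- `λ(A)`: the eigenvalues of a real symmetric matrix, with multiplicity
(the roots of the characteristic polynomial; all `n` of them are real if `A` is symmetric). -/
def eigs (A : Matrix (Fin n) (Fin n) ℝ) : Multiset ℝ := A.charpoly.roots

/-- `σₘ(A) = σₘ(λ(A))`, the `m`-th elementary symmetric function of the eigenvalues (`σ₀ = 1`). -/
def sigma (m : ℕ) (A : Matrix (Fin n) (Fin n) ℝ) : ℝ := (eigs A).esymm m

/-- `A ∈ Γₘ`, i.e. `λ(A) ∈ Γₘ = {σ₁ > 0, …, σₘ > 0}`. -/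
def InGamma (m : ℕ) (A : Matrix (Fin n) (Fin n) ℝ) : Prop :=
  ∀ j : ℕ, 1 ≤ j → j ≤ m → 0 < sigma j A

/-- On symmetric matrices `σₘ` is `∑_{i₁ < ⋯ < iₘ} λ_{i₁} ⋯ λ_{iₘ}`. -/
theorem sigma_eq_sum (m : ℕ) {A : Matrix (Fin n) (Fin n) ℝ} (hA : A.IsHermitian) :
    sigma m A =
      ∑ s ∈ Finset.powersetCard m (Finset.univ : Finset (Fin n)), ∏ i ∈ s, hA.eigenvalues i := by
  have h : eigs A = Multiset.map hA.eigenvalues Finset.univ.val := by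
    simpa [eigs] using hA.roots_charpoly_eq_eigenvalues
  rw [sigma, h, Finset.esymm_map_val]

/-- A bounded domain with smooth boundary: a bounded, nonempty, connected open set which near each
boundary point is the sublevel set `{ρ < 0}` of a smooth function `ρ` with nonzero differential at
that point. -/
structure IsSmoothBoundedDomain (Ω : Set (E n)) : Prop where
  isOpen : IsOpen Ω
  isConnected : IsConnected Ω
  isBounded : Bornology.IsBounded Ω
  smooth_boundary : ∀ x ∈ frontier Ω, ∃ U ∈ 𝓝 x, ∃ ρ : E n → ℝ,
    ContDiff ℝ ∞ ρ ∧ fderiv ℝ ρ x ≠ 0 ∧ ∀ y ∈ U, (y ∈ Ω ↔ ρ y < 0)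

/-- `‖f‖_{C^{1,1}(Ω)} = sup |f| + sup |Df| + Lip(Df)`, with values in `[0, ∞]`
(meaningful when `f` is differentiable on the open set `Ω`). -/
def c11Norm (Ω : Set (E n)) (f : E n → ℝ) : ℝ≥0∞ :=
  (⨆ x ∈ Ω, ‖f x‖ₑ) + (⨆ x ∈ Ω, ‖fderiv ℝ f x‖ₑ) +
    ⨆ x ∈ Ω, ⨆ y ∈ Ω, edist (fderiv ℝ f x) (fderiv ℝ f y) / edist x y

/-- `f ∈ C^{1,1}(Ω)` with `‖f‖_{C^{1,1}(Ω)} ≤ K`. -/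
def C11Bound (Ω : Set (E n)) (f : E n → ℝ) (K : ℝ≥0) : Prop :=
  DifferentiableOn ℝ f Ω ∧ c11Norm Ω f ≤ K

/-- `u ∈ C²(Ω̄)` (for `Ω` open): `u` is `C²` in `Ω` and continuous on `Ω̄`, and `Du`, `D²u` extend
continuously from `Ω` to `Ω̄`. -/
structure IsC2Closure (Ω : Set (E n)) (u : E n → ℝ) : Prop where
  contDiffOn : ContDiffOn ℝ 2 u Ω
  continuousOn : ContinuousOn u (closure Ω)
  gradient : ∃ D : E n → (E n →L[ℝ] ℝ),
    ContinuousOn D (closure Ω) ∧ Set.EqOn D (fderiv ℝ u) Ω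
  hessian : ∃ H : E n → Matrix (Fin n) (Fin n) ℝ,
    ContinuousOn H (closure Ω) ∧ Set.EqOn H (hessian u) Ω

/-- `D²u` on `Ω̄`: the extension by continuity of `D²u` from `Ω`. -/
def closureHessian (Ω : Set (E n)) (u : E n → ℝ) : E n → Matrix (Fin n) (Fin n) ℝ :=
  extendFrom Ω (hessian u)

/-- `closureHessian` is the continuous extension. -/
theorem closureHessian_eq {Ω : Set (E n)} {u : E n → ℝ}
    {H : E n → Matrix (Fin n) (Fin n) ℝ} (hc : ContinuousOn H (closure Ω))
    (he : Set.EqOn H (hessian u) Ω) : Set.EqOn (closureHessian Ω u) H (closure Ω) := by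
  intro x hx
  refine extendFrom_eq hx ?_
  have h1 : Filter.Tendsto H (𝓝[Ω] x) (𝓝 (H x)) := (hc x hx).mono_left (nhdsWithin_mono x subset_closure)
  exact h1.congr' (Filter.eventuallyEq_of_mem self_mem_nhdsWithin he)

/-- `u` is an admissible solution in `Ω` of
`σ_k(D²u) + α σ_{k-1}(D²u) = ∑_{ℓ=0}^{k-2} α_ℓ σ_ℓ(D²u)`, that is, a solution with
`D²u ∈ Γ_{k-1}` in `Ω`. -/
structure IsAdmissibleSolution (k : ℕ) (Ω : Set (E n)) (α : E n → ℝ) (a : ℕ → E n → ℝ)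
    (u : E n → ℝ) : Prop where
  admissible : ∀ x ∈ Ω, InGamma (k - 1) (hessian u x)
  equation : ∀ x ∈ Ω,
    sigma k (hessian u x) + α x * sigma (k - 1) (hessian u x) =
      ∑ l ∈ Finset.range (k - 1), a l x * sigma l (hessian u x)

end HessianEquation

end

open HessianEquation

/-! Put `m = k - 1` and `β_l = α_l^{1/(k-l)}`. Division by `σ_m` turns the equation into `F(D²u, β)
= -α`, where `F(A, β) = σ_{m+1}/σ_m(A) - ∑ β_l^{m+1-l} σ_l/σ_m(A)`. This `F` is homogeneous of
degree one, decreasing in `β ≥ 0`, and superadditive jointly in `(A, β)` on `Γ_m × {β ≥ 0}`, so it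
is jointly concave. Only second differences of `α` and `β` then matter: no sign of `α` and no
positive lower bound on `α_l` is needed.

Joint superadditivity (`quotientOperator_superadditive`) rests on that of `σ_{m+1}/σ_m`
(`GammaCone.superadditive` for vectors, `InGamma.superadditive` for matrices) and on a Hölder
inequality (`pow_div_prod_subadditive`).

At an interior maximum of `u_ee + N|x|²/2`, the matrix `Q = 2D²u(x) - D²u(x+te) - D²u(x-te)` is at
least `(N/2)t² I` for small `t`. Superadditivity and monotonicity give `F(Q, δ) ≤ α(x+te) + α(x-te)
- 2α(x) ≤ 2Kt²` with `δ = 2Kt²`, while `F(Q, δ) ≥ Nt²/(2n) - mδ`. A large `N` makes this impossible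
(`not_isLocalMax_hessian`), so pure second derivatives are bounded above by their boundary values;
positivity of the trace supplies the rest of the bound. -/

namespace HessianEquation

/-! ### Newton inequalities for real-rooted polynomials. -/

section RealRooted
open Polynomial

/-- Rolle's theorem, counted with multiplicity: differentiation loses at most one root, and it
lowers the degree by one. -/
theorem splits_derivative {p : ℝ[X]} (hp : p.Splits) : (derivative p).Splits := by
  rw [splits_iff_card_roots] at hp ⊢
  have h1 := card_roots_le_derivative p
  have h2 := natDegree_derivative_le p
  have h3 := card_roots' (derivative p)
  omega

theorem splits_iterate_derivative {p : ℝ[X]} (hp : p.Splits) (k : ℕ) :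
    (derivative^[k] p).Splits := by
  induction k with
  | zero => exact hp
  | succ k ih => rw [Function.iterate_succ_apply']; exact splits_derivative ih

/-- Adjoining a root `a` changes `D = p₁² - 2p₀p₂` into `a² D + p₀²`, so nonnegativity persists. -/
theorem laguerre_multiset (m : Multiset ℝ) :
    2 * (((m.map fun r => X - C r).prod).coeff 0 * ((m.map fun r => X - C r).prod).coeff 2) ≤
      ((m.map fun r => X - C r).prod).coeff 1 ^ 2 := by
  induction m using Multiset.induction with
  | empty => simp [coeff_one]
  | cons a m ih =>
    set p := (m.map fun r => X - C r).prod
    rw [Multiset.map_cons, Multiset.prod_cons]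
    have h0 : ((X - C a) * p).coeff 0 = -a * p.coeff 0 := by simp [sub_mul]
    have h1 : ((X - C a) * p).coeff 1 = p.coeff 0 - a * p.coeff 1 := by simp [sub_mul, coeff_X_mul]
    have h2 : ((X - C a) * p).coeff 2 = p.coeff 1 - a * p.coeff 2 := by simp [sub_mul, coeff_X_mul]
    rw [h0, h1, h2]
    nlinarith [mul_nonneg (sq_nonneg a) (sub_nonneg.2 ih), sq_nonneg (p.coeff 0)]

theorem laguerre {p : ℝ[X]} (hp : p.Splits) : 2 * (p.coeff 0 * p.coeff 2) ≤ p.coeff 1 ^ 2 := by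
  have h := hp.eq_prod_roots
  have hl := laguerre_multiset p.roots
  set q := (p.roots.map fun r => X - C r).prod
  rw [h]
  simp only [coeff_C_mul]
  nlinarith [mul_nonneg (sq_nonneg p.leadingCoeff) (sub_nonneg.2 hl)]

/-- The `i`-th derivative is still real-rooted, and `laguerre` for it reads `(i+2) pᵢ pᵢ₊₂ ≤ (i+1)
pᵢ₊₁²`; the sharper constant is discarded. -/
theorem newton_coeff {p : ℝ[X]} (hp : p.Splits) (i : ℕ) :
    p.coeff i * p.coeff (i + 2) ≤ p.coeff (i + 1) ^ 2 := by
  have h := laguerre (splits_iterate_derivative hp i)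
  simp only [coeff_iterate_derivative, nsmul_eq_mul] at h
  have e0 : (0 + i).descFactorial i = i.factorial := by simp [Nat.descFactorial_self]
  have e1 : (1 + i).descFactorial i = (i + 1) * i.factorial := by
    have := Nat.factorial_mul_descFactorial (n := 1 + i) (k := i) (by omega)
    rw [← Nat.factorial_succ, add_comm i 1]; simpa using this
  have e2 : 2 * (2 + i).descFactorial i = (i + 2) * ((i + 1) * i.factorial) := by
    have := Nat.factorial_mul_descFactorial (n := 2 + i) (k := i) (by omega)
    rw [← Nat.factorial_succ, ← Nat.factorial_succ, add_right_comm, add_comm i 2 ,]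
    simpa using this
  rw [e0, e1] at h
  have e2' : (2 : ℝ) * ((2 + i).descFactorial i : ℕ) = (i + 2) * ((i + 1) * i.factorial) := by
    exact_mod_cast e2
  have hf : (0 : ℝ) < i.factorial := by exact_mod_cast i.factorial_pos
  rw [zero_add, add_comm 2 i, add_comm 1 i] at h
  rw [add_comm 2 i] at e2'
  push_cast at h
  set f : ℝ := (i.factorial : ℝ)
  have hi : (0 : ℝ) ≤ i := i.cast_nonneg
  have h3 : ((i : ℝ) + 1) * f ^ 2 * ((i + 2) * (p.coeff i * p.coeff (i + 2))) ≤
      ((i : ℝ) + 1) * f ^ 2 * ((i + 1) * p.coeff (i + 1) ^ 2) := by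
    calc _ = 2 * (f * p.coeff i * (((i + 2).descFactorial i : ℕ) * p.coeff (i + 2))) := by
          linear_combination (-(f * p.coeff i * p.coeff (i + 2))) * e2'
      _ ≤ _ := h
      _ = _ := by ring
  have h4 := le_of_mul_le_mul_left h3 (by positivity)
  by_contra! hc
  nlinarith [sq_nonneg (p.coeff (i + 1)), mul_nonneg hi (sub_nonneg.2 hc.le)]

end RealRooted

/-! ### Elementary symmetric functions on Gårding cones. -/

section Esymm
variable {ι : Type*}

/-- The `k`-th elementary symmetric function of the numbers `x i`, `i ∈ s`. -/
def esym (s : Finset ι) (x : ι → ℝ) (k : ℕ) : ℝ := ∑ t ∈ s.powersetCard k, ∏ i ∈ t, x i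

theorem esym_eq_esymm (s : Finset ι) (x : ι → ℝ) (k : ℕ) :
    esym s x k = (s.val.map x).esymm k := (Finset.esymm_map_val x s k).symm

@[simp] theorem esym_zero (s : Finset ι) (x : ι → ℝ) : esym s x 0 = 1 := by simp [esym]

theorem esym_one (s : Finset ι) (x : ι → ℝ) : esym s x 1 = ∑ i ∈ s, x i := by
  simp [esym, Finset.powersetCard_one]

theorem esym_of_card_lt {s : Finset ι} {k : ℕ} (h : s.card < k) (x : ι → ℝ) : esym s x k = 0 := by
  simp [esym, Finset.powersetCard_eq_empty.2 h]

theorem esym_smul (s : Finset ι) (x : ι → ℝ) (c : ℝ) (k : ℕ) :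
    esym s (c • x) k = c ^ k * esym s x k := by
  rw [esym, esym, Finset.mul_sum]
  refine Finset.sum_congr rfl fun t ht => ?_
  simp [Finset.prod_mul_distrib, (Finset.mem_powersetCard.1 ht).2]

theorem newton_esym (s : Finset ι) (x : ι → ℝ) (j : ℕ) :
    esym s x j * esym s x (j + 2) ≤ esym s x (j + 1) ^ 2 := by
  by_cases h : s.card < j + 2
  · rw [esym_of_card_lt h]; simpa using sq_nonneg _
  push Not at h
  have hp : ((s.val.map x).map fun r => Polynomial.X + Polynomial.C r).prod.Splits := by
    refine Polynomial.Splits.multisetProd fun f hf => ?_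
    obtain ⟨r, -, rfl⟩ := Multiset.mem_map.1 hf
    exact Polynomial.Splits.X_add_C r
  have hc : (s.val.map x).card = s.card := by simp
  have hn := newton_coeff hp (s.card - (j + 2))
  rw [Multiset.prod_X_add_C_coeff _ (by omega), Multiset.prod_X_add_C_coeff _ (by omega),
    Multiset.prod_X_add_C_coeff _ (by omega), hc] at hn
  rw [show s.card - (s.card - (j + 2)) = j + 2 by omega,
    show s.card - (s.card - (j + 2) + 2) = j by omega,
    show s.card - (s.card - (j + 2) + 1) = j + 1 by omega] at hn
  simp only [esym_eq_esymm]
  linarith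

/-- The Gårding cone `{σ₁ > 0, …, σₘ > 0}` for the numbers `x i`, `i ∈ s`. -/
def GammaCone (s : Finset ι) (m : ℕ) : Set (ι → ℝ) := {x | ∀ j, 1 ≤ j → j ≤ m → 0 < esym s x j}

theorem GammaCone.esym_pos {s : Finset ι} {m : ℕ} {x : ι → ℝ} (hx : x ∈ GammaCone s m) {j : ℕ}
    (hj : j ≤ m) : 0 < esym s x j := by
  rcases Nat.eq_zero_or_pos j with rfl | h
  · simp
  · exact hx j h hj

theorem GammaCone.mono {s : Finset ι} {m m' : ℕ} (h : m' ≤ m) : GammaCone s m ⊆ GammaCone s m' :=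
  fun _ hx j h1 h2 => hx j h1 (h2.trans h)

variable [DecidableEq ι]

theorem esym_insert {s : Finset ι} {a : ι} (ha : a ∉ s) (x : ι → ℝ) (k : ℕ) :
    esym (insert a s) x (k + 1) = x a * esym s x k + esym s x (k + 1) := by
  rw [esym, Finset.powersetCard_succ_insert ha, Finset.sum_union, add_comm]
  · congr 1
    rw [Finset.sum_image, esym, Finset.mul_sum]
    · refine Finset.sum_congr rfl fun t ht => Finset.prod_insert fun h => ha ?_
      exact (Finset.mem_powersetCard.1 ht).1 h
    · intro t ht t' ht' h
      have h1 : a ∉ t := fun h => ha ((Finset.mem_powersetCard.1 ht).1 h)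
      have h2 : a ∉ t' := fun h => ha ((Finset.mem_powersetCard.1 ht').1 h)
      rw [← Finset.erase_insert h1, h, Finset.erase_insert h2]
  · rw [Finset.disjoint_left]
    intro t ht ht'
    obtain ⟨t', -, rfl⟩ := Finset.mem_image.1 ht'
    exact ha ((Finset.mem_powersetCard.1 ht).1 (Finset.mem_insert_self _ _))

theorem esym_erase {s : Finset ι} {a : ι} (ha : a ∈ s) (x : ι → ℝ) (k : ℕ) :
    esym s x (k + 1) = x a * esym (s.erase a) x k + esym (s.erase a) x (k + 1) := by
  conv_lhs => rw [← Finset.insert_erase ha]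
  exact esym_insert (Finset.notMem_erase a s) x k

/-- Euler's identity: each product of `k + 1` factors arises once for each of its factors. -/
theorem sum_mul_esym_erase (s : Finset ι) (x : ι → ℝ) (k : ℕ) :
    ∑ i ∈ s, x i * esym (s.erase i) x k = (k + 1) * esym s x (k + 1) := by
  induction s using Finset.induction generalizing k with
  | empty => rw [esym_of_card_lt (by simp)]; simp
  | insert a s ha ih =>
    rw [Finset.sum_insert ha, Finset.erase_insert ha, esym_insert ha]
    have he : ∀ i ∈ s, (insert a s).erase i = insert a (s.erase i) := fun i hi =>
      Finset.erase_insert_of_ne (fun h => ha (h ▸ hi))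
    cases k with
    | zero => simp [esym_one]
    | succ k =>
      have : ∀ i ∈ s, x i * esym ((insert a s).erase i) x (k + 1) =
          x a * (x i * esym (s.erase i) x k) + x i * esym (s.erase i) x (k + 1) := by
        intro i hi
        rw [he i hi, esym_insert (fun h => ha (Finset.mem_of_mem_erase h))]
        ring
      rw [Finset.sum_congr rfl this, Finset.sum_add_distrib, ← Finset.mul_sum, ih, ih]
      push_cast
      ring

/-- Let `a, b, c` be consecutive symmetric functions without `x i`, with `a > 0`. If `b ≤ 0`, then
`x i * a + b > 0` and `x i * b + c > 0` force `a c > b²`, against Newton's inequality. -/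
theorem GammaCone.erase {s : Finset ι} {m : ℕ} {x : ι → ℝ} (hx : x ∈ GammaCone s (m + 1)) {i : ι}
    (hi : i ∈ s) : x ∈ GammaCone (s.erase i) m := by
  have key : ∀ j ≤ m, 0 < esym (s.erase i) x j := by
    intro j
    induction j with
    | zero => simp
    | succ j ih =>
      intro hj
      have h0 := ih (by omega)
      by_contra! hc
      have h1 := GammaCone.esym_pos hx (j := j + 1) (by omega)
      have h2 := GammaCone.esym_pos hx (j := j + 2) (by omega)
      rw [esym_erase hi] at h1 h2
      have hn := newton_esym (s.erase i) x j
      set a := esym (s.erase i) x j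
      set b := esym (s.erase i) x (j + 1)
      set c := esym (s.erase i) x (j + 1 + 1)
      have h3 : 0 ≤ (x i * a + b) * (-b) := mul_nonneg h1.le (by linarith)
      nlinarith [mul_pos h0 h2]
  exact fun j _ hj => key j hj

theorem sq_div_add_sq_div {x y a b : ℝ} (ha : 0 < a) (hb : 0 < b) :
    (x + y) ^ 2 / (a + b) ≤ x ^ 2 / a + y ^ 2 / b := by
  rw [div_add_div _ _ ha.ne' hb.ne', div_le_div_iff₀ (by positivity) (by positivity)]
  nlinarith [sq_nonneg (x * b - y * a), mul_pos ha hb]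

/-- The Marcus–Lopes identity. -/
theorem marcus_lopes {s : Finset ι} {m : ℕ} {x : ι → ℝ} (hx : x ∈ GammaCone s (m + 1)) :
    (m + 2) * (esym s x (m + 2) / esym s x (m + 1)) =
      ∑ i ∈ s, (x i - x i ^ 2 / (x i + esym (s.erase i) x (m + 1) / esym (s.erase i) x m)) := by
  have h0 := GammaCone.esym_pos hx le_rfl
  have h1 : ∀ i ∈ s, x i - x i ^ 2 / (x i + esym (s.erase i) x (m + 1) / esym (s.erase i) x m) =
      x i * esym (s.erase i) x (m + 1) / esym s x (m + 1) := by
    intro i hi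
    have h2 := GammaCone.esym_pos (GammaCone.erase hx hi) le_rfl
    have h3 := esym_erase hi x m
    have h4 : x i + esym (s.erase i) x (m + 1) / esym (s.erase i) x m =
        esym s x (m + 1) / esym (s.erase i) x m := by
      rw [h3]; field_simp
    rw [h4]
    field_simp
    rw [h3]; ring
  rw [Finset.sum_congr rfl h1, ← Finset.sum_div, sum_mul_esym_erase]
  push_cast
  ring

/-- Induction on `m` over all index sets. `marcus_lopes` writes the quotient as a sum of `xᵢ -
xᵢ²/(xᵢ + qᵢ)`, where `qᵢ` is the lower quotient with `i` erased, superadditive by induction. Since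
`x²/a` is subadditive and decreasing in `a > 0`, each summand is superadditive. The cone membership
of `x + y` comes from the quotient inequality one level down. -/
theorem GammaCone.superadditive (m : ℕ) (s : Finset ι) {x y : ι → ℝ} (hx : x ∈ GammaCone s m)
    (hy : y ∈ GammaCone s m) : x + y ∈ GammaCone s m ∧
      esym s x (m + 1) / esym s x m + esym s y (m + 1) / esym s y m ≤
        esym s (x + y) (m + 1) / esym s (x + y) m := by
  induction m generalizing s with
  | zero =>
    refine ⟨fun j h1 h2 => by omega, ?_⟩
    simp [esym_one, Finset.sum_add_distrib]
  | succ m ih =>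
    have hxm := GammaCone.mono (Nat.le_succ m) hx
    have hym := GammaCone.mono (Nat.le_succ m) hy
    obtain ⟨hxy, hq⟩ := ih s hxm hym
    have hxy' : x + y ∈ GammaCone s (m + 1) := by
      intro j h1 h2
      rcases Nat.lt_or_ge j (m + 1) with h | h
      · exact hxy j h1 (by omega)
      obtain rfl : j = m + 1 := by omega
      have a1 := div_pos (GammaCone.esym_pos hx le_rfl) (GammaCone.esym_pos hxm le_rfl)
      have a2 := div_pos (GammaCone.esym_pos hy le_rfl) (GammaCone.esym_pos hym le_rfl)
      have a3 : 0 < esym s (x + y) (m + 1) / esym s (x + y) m := by linarith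
      exact (div_pos_iff_of_pos_right (GammaCone.esym_pos hxy le_rfl)).1 a3
    refine ⟨hxy', ?_⟩
    have hm : (0 : ℝ) < m + 2 := by positivity
    refine le_of_mul_le_mul_left ?_ hm
    rw [mul_add, marcus_lopes hx, marcus_lopes hy, marcus_lopes hxy', ← Finset.sum_add_distrib]
    refine Finset.sum_le_sum fun i hi => ?_
    have hpos : ∀ {z : ι → ℝ}, z ∈ GammaCone s (m + 1) →
        0 < z i + esym (s.erase i) z (m + 1) / esym (s.erase i) z m := by
      intro z hz
      have h2 := GammaCone.esym_pos (GammaCone.erase hz hi) le_rfl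
      have h3 := esym_erase hi z m
      have h4 : z i + esym (s.erase i) z (m + 1) / esym (s.erase i) z m =
          esym s z (m + 1) / esym (s.erase i) z m := by
        rw [h3]; field_simp
      rw [h4]
      exact div_pos (GammaCone.esym_pos hz le_rfl) h2
    obtain ⟨-, hi2⟩ := ih (s.erase i) (GammaCone.erase hx hi) (GammaCone.erase hy hi)
    have px := hpos hx
    have py := hpos hy
    have e1 := sq_div_add_sq_div (x := x i) (y := y i) px py
    have e2 : (x i + y i) ^ 2 / ((x + y) i + esym (s.erase i) (x + y) (m + 1) /
        esym (s.erase i) (x + y) m) ≤ (x i + y i) ^ 2 / (x i + esym (s.erase i) x (m + 1) /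
        esym (s.erase i) x m + (y i + esym (s.erase i) y (m + 1) / esym (s.erase i) y m)) := by
      refine div_le_div_of_nonneg_left (sq_nonneg _) (by linarith) ?_
      simp only [Pi.add_apply]
      linarith
    simp only [Pi.add_apply] at e2 ⊢
    linarith

end Esymm

/-! ### From vectors of eigenvalues to symmetric matrices. -/

section SymmetricMatrices
open Matrix
variable {n : ℕ}

theorem GammaCone.smul {ι : Type*} {s : Finset ι} {m : ℕ} {x : ι → ℝ} (hx : x ∈ GammaCone s m)
    {c : ℝ} (hc : 0 < c) : c • x ∈ GammaCone s m := fun j h1 h2 => by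
  rw [esym_smul]; exact mul_pos (pow_pos hc j) (hx j h1 h2)

theorem esym_ratio_smul {ι : Type*} (s : Finset ι) (x : ι → ℝ) {c : ℝ} (hc : c ≠ 0) (m : ℕ) :
    esym s (c • x) (m + 1) / esym s (c • x) m = c * (esym s x (m + 1) / esym s x m) := by
  rw [esym_smul, esym_smul, pow_succ, mul_assoc, mul_div_mul_left _ _ (pow_ne_zero m hc),
    mul_div_assoc]

theorem convex_gammaCone_ratio {ι : Type*} (s : Finset ι) (m : ℕ) (c : ℝ) :
    Convex ℝ {x | x ∈ GammaCone s m ∧ c ≤ esym s x (m + 1) / esym s x m} := by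
  classical
  rw [convex_iff_forall_pos]
  rintro x ⟨hx, hxc⟩ y ⟨hy, hyc⟩ a b ha hb hab
  obtain ⟨h1, h2⟩ := GammaCone.superadditive m s (GammaCone.smul hx ha) (GammaCone.smul hy hb)
  refine ⟨h1, le_trans ?_ h2⟩
  rw [esym_ratio_smul _ _ ha.ne', esym_ratio_smul _ _ hb.ne']
  calc c = a * c + b * c := by rw [← add_mul, hab, one_mul]
    _ ≤ _ := add_le_add (mul_le_mul_of_nonneg_left hxc ha.le) (mul_le_mul_of_nonneg_left hyc hb.le)

theorem esym_comp_perm {ι : Type*} [Fintype ι] (x : ι → ℝ) (π : Equiv.Perm ι) (m : ℕ) :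
    esym Finset.univ (x ∘ π) m = esym Finset.univ x m := by
  rw [esym_eq_esymm, esym_eq_esymm, ← Multiset.map_map]
  congr 2
  have := Finset.map_univ_equiv π
  exact congrArg Finset.val this

/-- By Birkhoff's theorem `S` is a convex combination of permutation matrices; the superlevel sets
of the quotient are convex and permutation invariant. -/
theorem doublyStochastic_mulVec_mem {m : ℕ} {x : Fin n → ℝ} (hx : x ∈ GammaCone Finset.univ m)
    {S : Matrix (Fin n) (Fin n) ℝ} (hS : S ∈ doublyStochastic ℝ (Fin n)) :
    S *ᵥ x ∈ GammaCone Finset.univ m ∧ esym Finset.univ x (m + 1) / esym Finset.univ x m ≤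
      esym Finset.univ (S *ᵥ x) (m + 1) / esym Finset.univ (S *ᵥ x) m := by
  set c := esym Finset.univ x (m + 1) / esym Finset.univ x m
  have hconv := (convex_gammaCone_ratio (Finset.univ : Finset (Fin n)) m c).linear_preimage
    ((Matrix.mulVecBilin ℝ ℝ).flip x)
  have hsub : {σ.permMatrix ℝ | σ : Equiv.Perm (Fin n)} ⊆
      ((Matrix.mulVecBilin ℝ ℝ).flip x) ⁻¹' {x | x ∈ GammaCone Finset.univ m ∧
        c ≤ esym Finset.univ x (m + 1) / esym Finset.univ x m} := by
    rintro _ ⟨σ, rfl⟩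
    have : ((Matrix.mulVecBilin ℝ ℝ).flip x) (σ.permMatrix ℝ) = x ∘ σ := by
      simp [Matrix.permMatrix_mulVec]
    rw [Set.mem_preimage, this]
    refine ⟨fun j h1 h2 => ?_, ?_⟩
    · rw [esym_comp_perm]; exact hx j h1 h2
    · rw [esym_comp_perm, esym_comp_perm]
  have h := convexHull_min hsub hconv
  rw [← doublyStochastic_eq_convexHull_permMatrix] at h
  exact h hS

theorem sigma_conj_diagonal (U : Matrix (Fin n) (Fin n) ℝ) (hU : Uᵀ * U = 1) (d : Fin n → ℝ)
    (m : ℕ) : sigma m (U * diagonal d * Uᵀ) = esym Finset.univ d m := by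
  have h : (U * diagonal d * Uᵀ).charpoly = (diagonal d).charpoly := by
    rw [mul_assoc, charpoly_mul_comm, mul_assoc, hU, mul_one]
  have h' : (∏ i, (Polynomial.X - Polynomial.C (d i))).roots = Finset.univ.val.map d := by
    rw [← Polynomial.roots_multiset_prod_X_sub_C (Finset.univ.val.map d), Multiset.map_map]
    rfl
  rw [sigma, eigs, h, charpoly_diagonal, h', esym_eq_esymm]

theorem sigma_eq_esym {A : Matrix (Fin n) (Fin n) ℝ} (hA : A.IsHermitian) (m : ℕ) :
    sigma m A = esym Finset.univ hA.eigenvalues m := sigma_eq_sum m hA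

theorem inGamma_iff {A : Matrix (Fin n) (Fin n) ℝ} (hA : A.IsHermitian) (m : ℕ) :
    InGamma m A ↔ hA.eigenvalues ∈ GammaCone Finset.univ m := by
  simp only [InGamma, GammaCone, Set.mem_ofPred_eq, sigma_eq_esym hA]

theorem exists_orthogonal_diagonalization {A : Matrix (Fin n) (Fin n) ℝ} (hA : A.IsHermitian) :
    ∃ U : Matrix (Fin n) (Fin n) ℝ, Uᵀ * U = 1 ∧ U * Uᵀ = 1 ∧
      A = U * diagonal hA.eigenvalues * Uᵀ := by
  refine ⟨hA.eigenvectorUnitary, ?_, ?_, ?_⟩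
  · have := Unitary.coe_star_mul_self hA.eigenvectorUnitary
    simpa [star_eq_conjTranspose, conjTranspose_eq_transpose_of_trivial] using this
  · have := Unitary.coe_mul_star_self hA.eigenvectorUnitary
    simpa [star_eq_conjTranspose, conjTranspose_eq_transpose_of_trivial] using this
  · have := hA.spectral_theorem
    rw [Unitary.conjStarAlgAut_apply] at this
    simpa [star_eq_conjTranspose, conjTranspose_eq_transpose_of_trivial, Function.comp_def]
      using this

theorem sigma_smul {A : Matrix (Fin n) (Fin n) ℝ} (hA : A.IsHermitian) (c : ℝ) (m : ℕ) :
    sigma m (c • A) = c ^ m * sigma m A := by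
  obtain ⟨U, h1, -, h3⟩ := exists_orthogonal_diagonalization hA
  have : c • A = U * diagonal (c • hA.eigenvalues) * Uᵀ := by
    conv_lhs => rw [h3]
    rw [diagonal_smul]; simp
  rw [this, sigma_conj_diagonal U h1, esym_smul, ← sigma_eq_esym hA]

theorem sq_entries_mem_doublyStochastic {O : Matrix (Fin n) (Fin n) ℝ} (h1 : O * Oᵀ = 1)
    (h2 : Oᵀ * O = 1) : (of fun i j => O i j ^ 2) ∈ doublyStochastic ℝ (Fin n) := by
  rw [mem_doublyStochastic_iff_sum]
  refine ⟨fun i j => sq_nonneg _, fun i => ?_, fun j => ?_⟩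
  · have := congrFun (congrFun h1 i) i
    simpa [mul_apply, sq] using this
  · have := congrFun (congrFun h2 j) j
    simpa [mul_apply, sq] using this

/-- The diagonal of a symmetric matrix in an orthonormal basis lies in the convex hull of the
permutations of its eigenvalues. -/
theorem diag_conj_mem_gammaCone {A : Matrix (Fin n) (Fin n) ℝ} (hA : A.IsHermitian) {m : ℕ}
    (hm : InGamma m A) {W : Matrix (Fin n) (Fin n) ℝ} (h1 : W * Wᵀ = 1) (h2 : Wᵀ * W = 1) :
    (Wᵀ * A * W).diag ∈ GammaCone Finset.univ m ∧ sigma (m + 1) A / sigma m A ≤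
      esym Finset.univ (Wᵀ * A * W).diag (m + 1) / esym Finset.univ (Wᵀ * A * W).diag m := by
  obtain ⟨U, hU1, hU2, hU⟩ := exists_orthogonal_diagonalization hA
  have hO1 : (Wᵀ * U) * (Wᵀ * U)ᵀ = 1 := by
    rw [transpose_mul, transpose_transpose, mul_assoc, ← mul_assoc U, hU2, one_mul, h2]
  have hO2 : (Wᵀ * U)ᵀ * (Wᵀ * U) = 1 := by
    rw [transpose_mul, transpose_transpose, mul_assoc, ← mul_assoc W, h1, one_mul, hU1]
  have hd : (Wᵀ * A * W).diag = (of fun i j => (Wᵀ * U) i j ^ 2) *ᵥ hA.eigenvalues := by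
    have : Wᵀ * A * W = (Wᵀ * U) * diagonal hA.eigenvalues * (Wᵀ * U)ᵀ := by
      conv_lhs => rw [hU]
      rw [transpose_mul, transpose_transpose]; simp only [mul_assoc]
    rw [this]
    ext i
    rw [diag_apply, mul_apply, mulVec, dotProduct]
    refine Finset.sum_congr rfl fun j _ => ?_
    rw [mul_diagonal, transpose_apply, of_apply]; ring
  rw [hd, sigma_eq_esym hA, sigma_eq_esym hA]
  exact doublyStochastic_mulVec_mem ((inGamma_iff hA m).1 hm)
    (sq_entries_mem_doublyStochastic hO1 hO2)

/-- In an orthonormal eigenbasis of `A + B`, its eigenvalues are the sum of the diagonals of `A` and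
`B`. Passing from eigenvalues to a diagonal does not decrease the quotient, so the vector case
applies. -/
theorem InGamma.superadditive {A B : Matrix (Fin n) (Fin n) ℝ} (hA : A.IsHermitian)
    (hB : B.IsHermitian) {m : ℕ} (hmA : InGamma m A) (hmB : InGamma m B) :
    InGamma m (A + B) ∧ sigma (m + 1) A / sigma m A + sigma (m + 1) B / sigma m B ≤
      sigma (m + 1) (A + B) / sigma m (A + B) := by
  have hAB := hA.add hB
  obtain ⟨W, h1, h2, hW⟩ := exists_orthogonal_diagonalization hAB
  have hd : hAB.eigenvalues = (Wᵀ * A * W).diag + (Wᵀ * B * W).diag := by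
    have : Wᵀ * A * W + Wᵀ * B * W = diagonal hAB.eigenvalues := by
      rw [← add_mul, ← mul_add]
      conv_lhs => rw [hW]
      simp only [mul_assoc]
      rw [h1, mul_one, ← mul_assoc, h1, one_mul]
    rw [← diag_add, this, diag_diagonal]
  obtain ⟨a1, a2⟩ := diag_conj_mem_gammaCone hA hmA h2 h1
  obtain ⟨b1, b2⟩ := diag_conj_mem_gammaCone hB hmB h2 h1
  obtain ⟨c1, c2⟩ := GammaCone.superadditive m Finset.univ a1 b1
  rw [← hd] at c1 c2
  refine ⟨(inGamma_iff hAB m).2 c1, ?_⟩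
  rw [sigma_eq_esym hAB, sigma_eq_esym hAB]
  linarith

theorem sigma_zero (A : Matrix (Fin n) (Fin n) ℝ) : sigma 0 A = 1 := by
  simp [sigma, Multiset.esymm]

theorem InGamma.sigma_pos {m : ℕ} {A : Matrix (Fin n) (Fin n) ℝ} (h : InGamma m A) {j : ℕ}
    (hj : j ≤ m) : 0 < sigma j A := by
  rcases Nat.eq_zero_or_pos j with rfl | h0
  · simp [sigma_zero]
  · exact h j h0 hj

theorem InGamma.mono {m j : ℕ} {A : Matrix (Fin n) (Fin n) ℝ} (h : InGamma m A) (hj : j ≤ m) :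
    InGamma j A := fun i h1 h2 => h i h1 (h2.trans hj)

theorem prod_sigma_ratio {l p : ℕ} {A : Matrix (Fin n) (Fin n) ℝ} (h : InGamma (l + p) A) :
    ∏ j ∈ Finset.range p, sigma (l + j + 1) A / sigma (l + j) A =
      sigma (l + p) A / sigma l A := by
  induction p with
  | zero => simp [div_self (h.sigma_pos (j := l) (by omega)).ne']
  | succ p ih =>
    rw [Finset.prod_range_succ, ih (h.mono (by omega))]
    have := h.sigma_pos (j := l + p) (by omega)
    have := h.sigma_pos (j := l) (by omega)
    rw [← add_assoc]
    field_simp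

end SymmetricMatrices

/-! ### A Hölder inequality for powers over products. -/

section Holder
open Finset

/-- AM-GM for the `p + 1` numbers `a j` and `r ^ (p + 1) / ∏ a j`, whose product is `r ^ (p + 1)`.
-/
theorem mul_le_pow_div_prod_add_sum {r : ℝ} (hr : 0 ≤ r) {p : ℕ} {a : ℕ → ℝ}
    (ha : ∀ j ∈ range p, 0 < a j) :
    (p + 1) * r ≤ r ^ (p + 1) / (∏ j ∈ range p, a j) + ∑ j ∈ range p, a j := by
  set P := ∏ j ∈ range p, a j with hP
  have hP0 : 0 < P := prod_pos ha
  set z : ℕ → ℝ := fun j => if j < p then a j else r ^ (p + 1) / P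
  have hz : ∀ j ∈ range (p + 1), 0 ≤ z j := by
    intro j _
    by_cases h : j < p
    · simp only [z, h, if_true]; exact (ha j (mem_range.2 h)).le
    · simp only [z, h, if_false]; positivity
  have hsum : ∑ j ∈ range (p + 1), z j = ∑ j ∈ range p, a j + r ^ (p + 1) / P := by
    rw [sum_range_succ]
    congr 1
    · exact sum_congr rfl fun j hj => by simp [z, mem_range.1 hj]
    · simp [z]
  have hprod : ∏ j ∈ range (p + 1), z j = r ^ (p + 1) := by
    rw [prod_range_succ, prod_congr rfl (g := a) fun j hj => by simp [z, mem_range.1 hj]]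
    simp only [z, lt_irrefl, if_false, ← hP]
    field_simp
  have h := Real.geom_mean_le_arith_mean (range (p + 1)) (fun _ => 1) z (by simp) (by simp; positivity) hz
  simp only [Real.rpow_one, sum_const, card_range, nsmul_eq_mul, mul_one, one_mul, hprod, hsum] at h
  rw [Real.pow_rpow_inv_natCast hr (by omega), le_div_iff₀ (by positivity)] at h
  push_cast at h
  linarith

/-- Hölder's inequality: `(β, a₁, …, aₚ) ↦ β ^ (p + 1) / (a₁ ⋯ aₚ)` is subadditive. -/
theorem pow_div_prod_subadditive {β γ : ℝ} (hβ : 0 ≤ β) (hγ : 0 ≤ γ) {p : ℕ} {a b : ℕ → ℝ}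
    (ha : ∀ j ∈ range p, 0 < a j) (hb : ∀ j ∈ range p, 0 < b j) :
    (β + γ) ^ (p + 1) / ∏ j ∈ range p, (a j + b j) ≤
      β ^ (p + 1) / ∏ j ∈ range p, a j + γ ^ (p + 1) / ∏ j ∈ range p, b j := by
  have hPa : 0 < ∏ j ∈ range p, a j := prod_pos ha
  have hPb : 0 < ∏ j ∈ range p, b j := prod_pos hb
  have hPc : 0 < ∏ j ∈ range p, (a j + b j) := prod_pos fun j hj => add_pos (ha j hj) (hb j hj)
  rcases (add_nonneg hβ hγ).eq_or_lt with h0 | h0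
  · rw [← h0, zero_pow (by omega), zero_div]; positivity
  have hu : ∀ j ∈ range p, 0 < a j / (a j + b j) := fun j hj =>
    div_pos (ha j hj) (add_pos (ha j hj) (hb j hj))
  have hv : ∀ j ∈ range p, 0 < b j / (a j + b j) := fun j hj =>
    div_pos (hb j hj) (add_pos (ha j hj) (hb j hj))
  -- After this normalization the two left sides add up to `p + 1` and the two sums on the right to
  -- `p`; the remaining power terms therefore add up to at least `1`.
  have h1 := mul_le_pow_div_prod_add_sum (r := β / (β + γ)) (by positivity) hu
  have h2 := mul_le_pow_div_prod_add_sum (r := γ / (β + γ)) (by positivity) hv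
  have h3 : ∑ j ∈ range p, a j / (a j + b j) + ∑ j ∈ range p, b j / (a j + b j) = p := by
    rw [← sum_add_distrib, sum_congr rfl (g := fun _ => (1 : ℝ))]
    · simp
    · intro j hj
      rw [← add_div, div_self (add_pos (ha j hj) (hb j hj)).ne']
  have h4 : β / (β + γ) + γ / (β + γ) = 1 := by rw [← add_div, div_self h0.ne']
  rw [prod_div_distrib, div_pow] at h1 h2
  have h5 : (p + 1 : ℝ) * (β / (β + γ)) + (p + 1) * (γ / (β + γ)) = p + 1 := by
    rw [← mul_add, h4, mul_one]
  set c := ∏ j ∈ range p, (a j + b j)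
  have h6 : 1 ≤ (c / (β + γ) ^ (p + 1)) * (β ^ (p + 1) / ∏ j ∈ range p, a j +
      γ ^ (p + 1) / ∏ j ∈ range p, b j) := by
    have e1 : β ^ (p + 1) / (β + γ) ^ (p + 1) / ((∏ j ∈ range p, a j) / c) +
        γ ^ (p + 1) / (β + γ) ^ (p + 1) / ((∏ j ∈ range p, b j) / c) =
        (c / (β + γ) ^ (p + 1)) * (β ^ (p + 1) / ∏ j ∈ range p, a j +
          γ ^ (p + 1) / ∏ j ∈ range p, b j) := by
      field_simp
    linarith
  rw [div_mul_eq_mul_div, le_div_iff₀ (by positivity)] at h6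
  rw [div_le_iff₀ hPc]
  linarith

end Holder

/-! ### The quotient operator: homogeneity, monotonicity, joint superadditivity. -/

section Operator
open Matrix
variable {n : ℕ}

/-- The operator `σₘ₊₁/σₘ(A) - ∑ₗ βₗ^(m+1-l) σₗ/σₘ(A)`. -/
noncomputable def quotientOperator (m : ℕ) (A : Matrix (Fin n) (Fin n) ℝ) (β : ℕ → ℝ) : ℝ :=
  sigma (m + 1) A / sigma m A - ∑ l ∈ Finset.range m, β l ^ (m + 1 - l) * (sigma l A / sigma m A)

theorem quotientOperator_smul {A : Matrix (Fin n) (Fin n) ℝ} (hA : A.IsHermitian) (m : ℕ)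
    (β : ℕ → ℝ) {c : ℝ} (hc : c ≠ 0) :
    quotientOperator m (c • A) (c • β) = c * quotientOperator m A β := by
  simp only [quotientOperator, sigma_smul hA, mul_sub, Finset.mul_sum]
  congr 1
  · rw [pow_succ, mul_assoc, mul_div_mul_left _ _ (pow_ne_zero m hc), mul_div_assoc]
  · refine Finset.sum_congr rfl fun l hl => ?_
    have hl := Finset.mem_range.1 hl
    have h : c ^ (m + 1 - l) * c ^ l = c * c ^ m := by
      rw [← pow_add, ← pow_succ']; congr 1; omega
    have hm := pow_ne_zero m hc
    rw [Pi.smul_apply, smul_eq_mul, mul_pow, mul_div_mul_comm]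
    calc _ = (c ^ (m + 1 - l) * c ^ l) / c ^ m * (β l ^ (m + 1 - l) * (sigma l A / sigma m A)) := by
          ring
      _ = _ := by rw [h, mul_div_cancel_right₀ _ hm]

theorem quotientOperator_antitone {A : Matrix (Fin n) (Fin n) ℝ} {m : ℕ} (hA : InGamma m A)
    {β γ : ℕ → ℝ} (hβ : ∀ l < m, 0 ≤ β l) (h : ∀ l < m, β l ≤ γ l) :
    quotientOperator m A γ ≤ quotientOperator m A β := by
  refine sub_le_sub_left (Finset.sum_le_sum fun l hl => ?_) _
  have hl := Finset.mem_range.1 hl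
  have := hA.sigma_pos hl.le
  have := hA.sigma_pos le_rfl
  exact mul_le_mul_of_nonneg_right (pow_le_pow_left₀ (hβ l hl) (h l hl) _) (by positivity)

/-- Telescoping `σ_m/σ_l` into consecutive quotients, each superadditive, puts the term in the form
required by `pow_div_prod_subadditive`. -/
theorem pow_mul_sigma_ratio {A : Matrix (Fin n) (Fin n) ℝ} {m : ℕ} (hA : InGamma m A) {l : ℕ}
    (hl : l < m) (b : ℝ) : b ^ (m + 1 - l) * (sigma l A / sigma m A) =
      b ^ (m - l + 1) / ∏ j ∈ Finset.range (m - l), sigma (l + j + 1) A / sigma (l + j) A := by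
  have e : l + (m - l) = m := by omega
  rw [prod_sigma_ratio (by rwa [e]), e, show m + 1 - l = m - l + 1 by omega, div_div_eq_mul_div,
    mul_div_assoc]

theorem quotientOperator_superadditive {A B : Matrix (Fin n) (Fin n) ℝ} (hA : A.IsHermitian)
    (hB : B.IsHermitian) {m : ℕ} (hmA : InGamma m A) (hmB : InGamma m B) {β γ : ℕ → ℝ}
    (hβ : ∀ l < m, 0 ≤ β l) (hγ : ∀ l < m, 0 ≤ γ l) :
    quotientOperator m A β + quotientOperator m B γ ≤ quotientOperator m (A + B) (β + γ) := by
  obtain ⟨hAB, h1⟩ := InGamma.superadditive hA hB hmA hmB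
  have h2 : ∑ l ∈ Finset.range m, (β + γ) l ^ (m + 1 - l) * (sigma l (A + B) / sigma m (A + B)) ≤
      ∑ l ∈ Finset.range m, β l ^ (m + 1 - l) * (sigma l A / sigma m A) +
      ∑ l ∈ Finset.range m, γ l ^ (m + 1 - l) * (sigma l B / sigma m B) := by
    rw [← Finset.sum_add_distrib]
    refine Finset.sum_le_sum fun l hl => ?_
    have hl := Finset.mem_range.1 hl
    rw [pow_mul_sigma_ratio hmA hl, pow_mul_sigma_ratio hmB hl, pow_mul_sigma_ratio hAB hl]
    have pos : ∀ {M : Matrix (Fin n) (Fin n) ℝ}, InGamma m M → ∀ j ∈ Finset.range (m - l),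
        0 < sigma (l + j + 1) M / sigma (l + j) M := by
      intro M hM j hj
      have := Finset.mem_range.1 hj
      exact div_pos (hM.sigma_pos (by omega)) (hM.sigma_pos (by omega))
    -- It remains to compare denominators: every consecutive quotient of `A + B` dominates the sum
    -- of those of `A` and `B`.
    refine le_trans ?_ (pow_div_prod_subadditive (hβ l hl) (hγ l hl) (pos hmA) (pos hmB))
    refine div_le_div_of_nonneg_left (pow_nonneg (add_nonneg (hβ l hl) (hγ l hl)) _)
      (Finset.prod_pos fun j hj => add_pos (pos hmA j hj) (pos hmB j hj))
      (Finset.prod_le_prod (fun j hj => (add_pos (pos hmA j hj) (pos hmB j hj)).le) fun j hj => ?_)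
    have := Finset.mem_range.1 hj
    exact (InGamma.superadditive hA hB (hmA.mono (by omega)) (hmB.mono (by omega))).2
  unfold quotientOperator
  linarith

theorem InGamma.smul {A : Matrix (Fin n) (Fin n) ℝ} (hA : A.IsHermitian) {m : ℕ}
    (hm : InGamma m A) {c : ℝ} (hc : 0 < c) : InGamma m (c • A) := fun j h1 h2 => by
  rw [sigma_smul hA]; exact mul_pos (pow_pos hc j) (hm j h1 h2)

/-- By Euler's identity `(j+1)σ_{j+1} = ∑ xᵢ σ_j(x|i) ≥ ρ ∑ σ_j(x|i) = ρ (|s| - j) σ_j`, where `x|i`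
omits `xᵢ`; finally `j + 1 ≤ |s|`. -/
theorem le_esym_ratio {s : Finset (Fin n)} {x : Fin n → ℝ} {ρ : ℝ} (hρ : 0 < ρ)
    (hx : ∀ i ∈ s, ρ ≤ x i) {j : ℕ} (hj : j + 1 ≤ s.card) :
    0 < esym s x j ∧ ρ / s.card ≤ esym s x (j + 1) / esym s x j := by
  have hpos : ∀ (t : Finset (Fin n)), t ⊆ s → ∀ k, 0 ≤ esym t x k := fun t ht k =>
    Finset.sum_nonneg fun r hr => Finset.prod_nonneg fun i hi =>
      hρ.le.trans (hx i (ht ((Finset.mem_powersetCard.1 hr).1 hi)))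
  have hj0 : 0 < esym s x j := by
    refine Finset.sum_pos (fun r hr => Finset.prod_pos fun i hi =>
      hρ.trans_le (hx i ((Finset.mem_powersetCard.1 hr).1 hi))) ?_
    exact Finset.powersetCard_nonempty.2 (by omega)
  refine ⟨hj0, ?_⟩
  have h1 := sum_mul_esym_erase s x j
  have h2 : ∑ i ∈ s, ρ * esym (s.erase i) x j ≤ ∑ i ∈ s, x i * esym (s.erase i) x j :=
    Finset.sum_le_sum fun i hi =>
      mul_le_mul_of_nonneg_right (hx i hi) (hpos _ (Finset.erase_subset _ _) _)
  have h3 : ((s.card : ℝ) - j) * esym s x j = ∑ i ∈ s, esym (s.erase i) x j := by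
    cases j with
    | zero => simp
    | succ j =>
      have e : ∀ i ∈ s, esym (s.erase i) x (j + 1) =
          esym s x (j + 1) - x i * esym (s.erase i) x j := fun i hi => by
        rw [esym_erase hi]; ring
      rw [Finset.sum_congr rfl e, Finset.sum_sub_distrib, sum_mul_esym_erase]
      simp only [Finset.sum_const, nsmul_eq_mul]
      push_cast; ring
  rw [← Finset.mul_sum, ← h3, h1] at h2
  have hc : (j : ℝ) + 1 ≤ s.card := by exact_mod_cast hj
  have hc0 : (0 : ℝ) < s.card := by have := j.cast_nonneg (α := ℝ); linarith
  rw [div_le_div_iff₀ hc0 hj0]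
  have h4 : ρ * esym s x j ≤ ρ * (((s.card : ℝ) - j) * esym s x j) := by
    refine mul_le_mul_of_nonneg_left ?_ hρ.le
    nlinarith
  have h5 : ((j : ℝ) + 1) * esym s x (j + 1) ≤ s.card * esym s x (j + 1) :=
    mul_le_mul_of_nonneg_right hc (hpos s (Finset.Subset.refl s) _)
  linarith

theorem le_eigenvalues {Q : Matrix (Fin n) (Fin n) ℝ} (hQ : Q.IsHermitian) {ρ : ℝ}
    (h : ∀ ξ : Fin n → ℝ, ρ * (ξ ⬝ᵥ ξ) ≤ ξ ⬝ᵥ Q *ᵥ ξ) (i : Fin n) : ρ ≤ hQ.eigenvalues i := by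
  have h1 := hQ.eigenvalues_eq i
  have h2 := h (hQ.eigenvectorBasis i)
  have h3 : (hQ.eigenvectorBasis i : Fin n → ℝ) ⬝ᵥ (hQ.eigenvectorBasis i : Fin n → ℝ) = 1 := by
    have := hQ.eigenvectorBasis.orthonormal.1 i
    rw [EuclideanSpace.norm_eq, Real.sqrt_eq_one] at this
    simpa [dotProduct, sq] using this
  rw [h3, mul_one] at h2
  simpa [h1] using h2

/-- Lower bound of the operator on matrices `Q ≥ ρ I` with coefficients at most `ρ / n`. -/
theorem le_quotientOperator_of_posDef {Q : Matrix (Fin n) (Fin n) ℝ} (hQ : Q.IsHermitian) {ρ : ℝ}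
    (hρ : 0 < ρ) (h : ∀ ξ : Fin n → ℝ, ρ * (ξ ⬝ᵥ ξ) ≤ ξ ⬝ᵥ Q *ᵥ ξ) {m : ℕ} (hm : m + 1 ≤ n)
    {δ : ℝ} (hδ : 0 ≤ δ) (hδρ : δ ≤ ρ / n) :
    InGamma m Q ∧ ρ / n - m * δ ≤ quotientOperator m Q (fun _ => δ) := by
  have hn : (0 : ℝ) < n := by exact_mod_cast (by omega : 0 < n)
  have key : ∀ j, j + 1 ≤ n → 0 < sigma j Q ∧ ρ / n ≤ sigma (j + 1) Q / sigma j Q := by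
    intro j hj
    rw [sigma_eq_esym hQ, sigma_eq_esym hQ]
    simpa using le_esym_ratio (s := Finset.univ) hρ (fun i _ => le_eigenvalues hQ h i)
      (j := j) (by simpa using hj)
  have hG : InGamma m Q := fun j _ hj => (key j (by omega)).1
  refine ⟨hG, ?_⟩
  have h1 := (key m hm).2
  have h2 : ∑ l ∈ Finset.range m, δ ^ (m + 1 - l) * (sigma l Q / sigma m Q) ≤
      ∑ l ∈ Finset.range m, δ := by
    refine Finset.sum_le_sum fun l hl => ?_
    have hl := Finset.mem_range.1 hl
    rw [pow_mul_sigma_ratio hG hl]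
    have hρn : 0 < ρ / n := by positivity
    have h3 : (ρ / n) ^ (m - l) ≤
        ∏ j ∈ Finset.range (m - l), sigma (l + j + 1) Q / sigma (l + j) Q := by
      have := Finset.prod_le_prod (s := Finset.range (m - l)) (f := fun _ => ρ / n)
        (g := fun j => sigma (l + j + 1) Q / sigma (l + j) Q) (fun j _ => hρn.le)
        (fun j hj => (key (l + j) (by have := Finset.mem_range.1 hj; omega)).2)
      simpa only [Finset.prod_const, Finset.card_range] using this
    rw [div_le_iff₀ ((pow_pos hρn _).trans_le h3), pow_succ']
    exact mul_le_mul_of_nonneg_left ((pow_le_pow_left₀ hδ hδρ _).trans h3) hδ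
  simp only [Finset.sum_const, Finset.card_range, nsmul_eq_mul] at h2
  unfold quotientOperator
  linarith

end Operator

/-! ### Symmetric second differences and symmetry of higher derivatives. -/

section SecondDifferences
variable {V F : Type*} [NormedAddCommGroup V] [NormedSpace ℝ V] [NormedAddCommGroup F]
  [NormedSpace ℝ F]

/-- Mean value inequality for `s ↦ Φ(x + se) + Φ(x - se) - s²B`. The choice `B = 0` serves `C^{1,1}`
functions, and `B = Φ''(e, e)` twice differentiable ones. -/
theorem norm_symmetric_difference_le {Φ : V → F} {Φ' : V → V →L[ℝ] F} {x e : V} {B : F} {t c : ℝ}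
    (ht : 0 ≤ t) (hΦ : ∀ s ∈ Set.Icc 0 t, HasFDerivAt Φ (Φ' (x + s • e)) (x + s • e) ∧
      HasFDerivAt Φ (Φ' (x - s • e)) (x - s • e))
    (hc : ∀ s ∈ Set.Icc 0 t, ‖Φ' (x + s • e) e - Φ' (x - s • e) e - (2 * s) • B‖ ≤ c) :
    ‖Φ (x + t • e) + Φ (x - t • e) - (2 : ℝ) • Φ x - t ^ 2 • B‖ ≤ c * t := by
  have hg : ∀ s ∈ Set.Icc 0 t, HasDerivWithinAt
      (fun s : ℝ => Φ (x + s • e) + Φ (x - s • e) - s ^ 2 • B)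
      (Φ' (x + s • e) e - Φ' (x - s • e) e - (2 * s) • B) (Set.Icc 0 t) s := by
    intro s hs
    obtain ⟨h1, h2⟩ := hΦ s hs
    have l1 : HasDerivAt (fun s : ℝ => x + s • e) e s := by
      simpa using ((hasDerivAt_id s).smul_const e).const_add x
    have l2 : HasDerivAt (fun s : ℝ => x - s • e) (-e) s := by
      simpa using ((hasDerivAt_id s).smul_const e).const_sub x
    have h3 := h1.comp_hasDerivAt s l1
    have h4 := h2.comp_hasDerivAt s l2
    have h5 := (hasDerivAt_pow 2 s).smul_const B
    have := ((h3.add h4).sub h5).hasDerivWithinAt (s := Set.Icc 0 t)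
    refine (this.congr_deriv ?_).congr (fun _ _ => rfl) rfl
    simp [sub_eq_add_neg]
  have := norm_image_sub_le_of_norm_deriv_le_segment' hg
    (fun s hs => hc s (Set.Ico_subset_Icc_self hs)) t (Set.right_mem_Icc.2 ht)
  simp only [zero_smul, add_zero, sub_zero, ne_eq, OfNat.ofNat_ne_zero, not_false_eq_true,
    zero_pow] at this
  rw [two_smul]
  convert this using 2
  abel

/-- Vector values matter: with `Φ = D²u` the estimate holds in operator norm, hence for all
directions `ξ` with the same `t`. -/
theorem eventually_norm_second_difference_le {Φ : V → F} {Φ' : V → V →L[ℝ] F} {x : V}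
    {Φ'' : V →L[ℝ] V →L[ℝ] F} (h1 : ∀ᶠ y in 𝓝 x, HasFDerivAt Φ (Φ' y) y)
    (h2 : HasFDerivAt Φ' Φ'' x) (e : V) {ε : ℝ} (hε : 0 < ε) :
    ∀ᶠ t in 𝓝[>] (0 : ℝ),
      ‖Φ (x + t • e) + Φ (x - t • e) - (2 : ℝ) • Φ x - t ^ 2 • Φ'' e e‖ ≤ ε * t ^ 2 := by
  set η := ε / (2 * (‖e‖ ^ 2 + 1)) with hη
  have hη0 : 0 < η := by positivity
  have h3 := h2.isLittleO.def hη0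
  obtain ⟨r, hr, hball⟩ := Metric.eventually_nhds_iff.1 (h1.and h3)
  have hr' : 0 < r / (‖e‖ + 1) := by positivity
  filter_upwards [Ioo_mem_nhdsGT hr'] with t ht
  have hdist : ∀ s ∈ Set.Icc 0 t, s * ‖e‖ < r := by
    intro s hs
    have := (lt_div_iff₀ (by positivity)).1 ht.2
    nlinarith [norm_nonneg e, hs.1, hs.2]
  have hp : ∀ s ∈ Set.Icc 0 t, dist (x + s • e) x < r := by
    intro s hs
    simpa [dist_eq_norm, norm_smul, abs_of_nonneg hs.1] using hdist s hs
  have hm : ∀ s ∈ Set.Icc 0 t, dist (x - s • e) x < r := by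
    intro s hs
    simpa [dist_eq_norm, norm_smul, abs_of_nonneg hs.1] using hdist s hs
  have := norm_symmetric_difference_le (Φ := Φ) (Φ' := Φ') (x := x) (e := e) (B := Φ'' e e)
    (c := ε * t) ht.1.le
    (fun s hs => ⟨(hball (hp s hs)).1, (hball (hm s hs)).1⟩) (by
      intro s hs
      have a1 := (hball (hp s hs)).2
      have a2 := (hball (hm s hs)).2
      rw [add_sub_cancel_left, norm_smul, Real.norm_of_nonneg hs.1] at a1
      rw [sub_sub_cancel_left, norm_neg, norm_smul, Real.norm_of_nonneg hs.1] at a2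
      set R1 := Φ' (x + s • e) - Φ' x - Φ'' (s • e)
      set R2 := Φ' (x - s • e) - Φ' x - Φ'' (-(s • e)) with hR2
      have e1 : Φ' (x + s • e) e - Φ' (x - s • e) e - (2 * s) • Φ'' e e = R1 e - R2 e := by
        simp only [R1, R2, _root_.sub_apply, map_neg, map_smul,
          _root_.neg_apply, _root_.smul_apply]
        module
      rw [e1]
      calc ‖R1 e - R2 e‖ ≤ ‖R1‖ * ‖e‖ + ‖R2‖ * ‖e‖ :=
            (norm_sub_le _ _).trans (add_le_add (R1.le_opNorm e) (R2.le_opNorm e))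
        _ ≤ η * (s * ‖e‖) * ‖e‖ + η * (s * ‖e‖) * ‖e‖ := by gcongr
        _ = (2 * η * ‖e‖ ^ 2) * s := by ring
        _ ≤ ε * s := by
            refine mul_le_mul_of_nonneg_right ?_ hs.1
            have : 2 * η * (‖e‖ ^ 2 + 1) = ε := by rw [hη]; field_simp
            nlinarith
        _ ≤ ε * t := by gcongr; exact hs.2)
  linarith [this]

theorem fderiv_clm_apply_const {W : Type*} [NormedAddCommGroup W] [NormedSpace ℝ W]
    {Φ : V → W →L[ℝ] F} {x : V} (h : DifferentiableAt ℝ Φ x) (c : W) (a : V) :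
    fderiv ℝ (fun y => Φ y c) x a = fderiv ℝ Φ x a c := by
  have := (h.hasFDerivAt.clm_apply (hasFDerivAt_const c x)).fderiv
  rw [this]; simp

theorem fderiv_fderiv_symm {f : V → F} {x : V} (hf : ContDiffAt ℝ 2 f x) (a b : V) :
    fderiv ℝ (fderiv ℝ f) x a b = fderiv ℝ (fderiv ℝ f) x b a :=
  (hf.isSymmSndFDerivAt (by simp)) a b

theorem contDiffAt_fderiv {m n : ℕ} {f : V → F} {x : V} (hf : ContDiffAt ℝ n f x)
    (h : m + 1 ≤ n) : ContDiffAt ℝ m (fderiv ℝ f) x :=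
  hf.fderiv_right (by exact_mod_cast h)

theorem eventually_contDiffAt {n : ℕ} {f : V → F} {x : V} (hf : ContDiffAt ℝ n f x) :
    ∀ᶠ y in 𝓝 x, ContDiffAt ℝ n f y :=
  hf.eventually (by simp)

theorem fderiv_fderiv_fderiv_swap {f : V → F} {x : V} (hf : ContDiffAt ℝ 3 f x) (a b c : V) :
    fderiv ℝ (fderiv ℝ (fderiv ℝ f)) x a b c = fderiv ℝ (fderiv ℝ (fderiv ℝ f)) x a c b := by
  have hf : ContDiffAt ℝ (3 : ℕ) f x := hf
  have h1 := contDiffAt_fderiv (m := 2) hf le_rfl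
  have h2 := contDiffAt_fderiv (m := 1) h1 le_rfl
  have h3 : DifferentiableAt ℝ (fderiv ℝ (fderiv ℝ f)) x := h2.differentiableAt (by simp)
  have hev : (fun y => fderiv ℝ (fderiv ℝ f) y b c) =ᶠ[𝓝 x]
      fun y => fderiv ℝ (fderiv ℝ f) y c b := by
    filter_upwards [eventually_contDiffAt hf] with y hy
    exact fderiv_fderiv_symm (hy.of_le (by norm_num)) b c
  have key : ∀ b c, fderiv ℝ (fun y => fderiv ℝ (fderiv ℝ f) y b c) x a =
      fderiv ℝ (fderiv ℝ (fderiv ℝ f)) x a b c := by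
    intro b c
    rw [fderiv_clm_apply_const (Φ := fun y => fderiv ℝ (fderiv ℝ f) y b)
      (h3.clm_apply (differentiableAt_const b)), fderiv_clm_apply_const h3]
  rw [← key b c, ← key c b, hev.fderiv_eq]

/-- Symmetry of the fourth derivative. -/
theorem fderiv_four_symm {f : V → F} {x : V} (hf : ContDiffAt ℝ 4 f x) (a b : V) :
    fderiv ℝ (fderiv ℝ (fderiv ℝ (fderiv ℝ f))) x a a b b =
      fderiv ℝ (fderiv ℝ (fderiv ℝ (fderiv ℝ f))) x b b a a := by
  have hf : ContDiffAt ℝ (4 : ℕ) f x := hf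
  have h1 := contDiffAt_fderiv (m := 3) hf le_rfl
  have h2 := contDiffAt_fderiv (m := 2) h1 le_rfl
  have h3 := contDiffAt_fderiv (m := 1) h2 le_rfl
  have hd : DifferentiableAt ℝ (fderiv ℝ (fderiv ℝ (fderiv ℝ f))) x := h3.differentiableAt (by simp)
  have s12 : ∀ p q : V, fderiv ℝ (fderiv ℝ (fderiv ℝ (fderiv ℝ f))) x p q =
      fderiv ℝ (fderiv ℝ (fderiv ℝ (fderiv ℝ f))) x q p := fun p q => fderiv_fderiv_symm h2 p q
  have s23 : ∀ p q r : V, fderiv ℝ (fderiv ℝ (fderiv ℝ (fderiv ℝ f))) x p q r =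
      fderiv ℝ (fderiv ℝ (fderiv ℝ (fderiv ℝ f))) x p r q :=
    fun p q r => fderiv_fderiv_fderiv_swap h1 p q r
  have s34 : ∀ p q r s : V, fderiv ℝ (fderiv ℝ (fderiv ℝ (fderiv ℝ f))) x p q r s =
      fderiv ℝ (fderiv ℝ (fderiv ℝ (fderiv ℝ f))) x p q s r := by
    intro p q r s
    have key : ∀ b c, fderiv ℝ (fun y => fderiv ℝ (fderiv ℝ (fderiv ℝ f)) y q b c) x p =
        fderiv ℝ (fderiv ℝ (fderiv ℝ (fderiv ℝ f))) x p q b c := by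
      intro b c
      have hd1 : DifferentiableAt ℝ (fun y => fderiv ℝ (fderiv ℝ (fderiv ℝ f)) y q) x :=
        DifferentiableAt.clm_apply (c := fderiv ℝ (fderiv ℝ (fderiv ℝ f))) (u := fun _ => q) hd
          (differentiableAt_const q)
      rw [fderiv_clm_apply_const (Φ := fun y => fderiv ℝ (fderiv ℝ (fderiv ℝ f)) y q b)
        (hd1.clm_apply (differentiableAt_const b)),
        fderiv_clm_apply_const (Φ := fun y => fderiv ℝ (fderiv ℝ (fderiv ℝ f)) y q) hd1,
        fderiv_clm_apply_const hd]
    have hev : (fun y => fderiv ℝ (fderiv ℝ (fderiv ℝ f)) y q r s) =ᶠ[𝓝 x]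
        fun y => fderiv ℝ (fderiv ℝ (fderiv ℝ f)) y q s r := by
      filter_upwards [eventually_contDiffAt hf] with y hy
      exact fderiv_fderiv_fderiv_swap (hy.of_le (by norm_num)) q r s
    rw [← key r s, ← key s r, hev.fderiv_eq]
  -- The slots pass through `aabb → abab → baab → baba → bbaa`.
  rw [s23 a a b, s12 a b, s34 b a a b, s23 b a b]

end SecondDifferences

/-! ### Second differences of `C^{1,1}` functions. -/

section C11
variable {n : ℕ}

theorem C11Bound.norm_fderiv_sub_le {Ω : Set (E n)} {f : E n → ℝ} {K : ℝ≥0} (h : C11Bound Ω f K)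
    {x y : E n} (hx : x ∈ Ω) (hy : y ∈ Ω) : ‖fderiv ℝ f x - fderiv ℝ f y‖ ≤ K * ‖x - y‖ := by
  rcases eq_or_ne x y with rfl | hne
  · simp
  have h1 : edist (fderiv ℝ f x) (fderiv ℝ f y) / edist x y ≤ K := by
    refine le_trans ?_ (le_trans le_add_self h.2)
    exact le_iSup₂_of_le x hx (le_iSup₂_of_le y hy le_rfl)
  rw [ENNReal.div_le_iff (by simpa using hne) (edist_ne_top x y), edist_dist, edist_dist,
    ← ENNReal.ofReal_coe_nnreal, ← ENNReal.ofReal_mul (NNReal.coe_nonneg K),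
    ENNReal.ofReal_le_ofReal_iff (by positivity), dist_eq_norm, dist_eq_norm] at h1
  exact h1

theorem C11Bound.abs_second_difference_le {Ω : Set (E n)} (hΩ : IsOpen Ω) {f : E n → ℝ} {K : ℝ≥0}
    (h : C11Bound Ω f K) {x e : E n} (he : ‖e‖ = 1) {r t : ℝ} (hr : Metric.ball x r ⊆ Ω)
    (ht : 0 ≤ t) (htr : t < r) : |f (x + t • e) + f (x - t • e) - 2 * f x| ≤ 2 * K * t ^ 2 := by
  have hp : ∀ s ∈ Set.Icc 0 t, x + s • e ∈ Ω := fun s hs => hr (by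
    simpa [norm_smul, he, abs_of_nonneg hs.1] using hs.2.trans_lt htr)
  have hm : ∀ s ∈ Set.Icc 0 t, x - s • e ∈ Ω := fun s hs => hr (by
    simpa [dist_eq_norm, norm_smul, he, abs_of_nonneg hs.1] using hs.2.trans_lt htr)
  have hd : ∀ y ∈ Ω, HasFDerivAt f (fderiv ℝ f y) y := fun y hy =>
    (h.1.differentiableAt (hΩ.mem_nhds hy)).hasFDerivAt
  have := norm_symmetric_difference_le (Φ := f) (Φ' := fderiv ℝ f) (x := x) (e := e) (B := 0)
    (c := 2 * K * t) ht (fun s hs => ⟨hd _ (hp s hs), hd _ (hm s hs)⟩) (by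
      intro s hs
      have h1 := h.norm_fderiv_sub_le (hp s hs) (hm s hs)
      have h2 : x + s • e - (x - s • e) = (2 * s) • e := by module
      rw [h2, norm_smul, he, Real.norm_of_nonneg (by linarith [hs.1])] at h1
      rw [smul_zero, sub_zero, ← _root_.sub_apply]
      refine (ContinuousLinearMap.le_opNorm _ _).trans ?_
      rw [he, mul_one]
      refine h1.trans ?_
      nlinarith [K.2, hs.2, mul_le_mul_of_nonneg_left hs.2 K.2])
  rw [smul_zero, sub_zero, Real.norm_eq_abs, smul_eq_mul] at this
  linarith

end C11

/-! ### The Hessian as a quadratic form and the second derivative test. -/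

section Hessian
open Matrix
variable {n : ℕ}

theorem toLp_eq_sum (ξ : Fin n → ℝ) : WithLp.toLp 2 ξ = ∑ i, ξ i • stdVec i := by
  ext j
  simp [stdVec, Pi.single_apply]

theorem dotProduct_of_mulVec (B : E n →L[ℝ] E n →L[ℝ] ℝ) (ξ η : Fin n → ℝ) :
    ξ ⬝ᵥ (Matrix.of fun i j => B (stdVec i) (stdVec j)) *ᵥ η =
      B (WithLp.toLp 2 ξ) (WithLp.toLp 2 η) := by
  rw [toLp_eq_sum, toLp_eq_sum]
  simp only [map_sum, map_smul, _root_.sum_apply, _root_.smul_apply,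
    smul_eq_mul, dotProduct, mulVec, of_apply, Finset.mul_sum]
  rw [Finset.sum_comm]
  refine Finset.sum_congr rfl fun i _ => Finset.sum_congr rfl fun j _ => ?_
  ring

theorem dotProduct_hessian_mulVec (u : E n → ℝ) (x : E n) (ξ η : Fin n → ℝ) :
    ξ ⬝ᵥ hessian u x *ᵥ η =
      fderiv ℝ (fderiv ℝ u) x (WithLp.toLp 2 ξ) (WithLp.toLp 2 η) :=
  dotProduct_of_mulVec _ ξ η

theorem hessian_isHermitian {u : E n → ℝ} {x : E n} (h : ContDiffAt ℝ 2 u x) :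
    (hessian u x).IsHermitian := by
  ext i j
  simp only [hessian, conjTranspose_apply, of_apply, star_trivial]
  exact fderiv_fderiv_symm h _ _

theorem dotProduct_self_eq (ξ : Fin n → ℝ) : ξ ⬝ᵥ ξ = ‖WithLp.toLp 2 ξ‖ ^ 2 := by
  rw [EuclideanSpace.norm_sq_eq]
  simp [dotProduct, sq]

/-- Second derivative test. -/
theorem fderiv_fderiv_le_of_isLocalMax {v : E n → ℝ} {x : E n} {N : ℝ} (hv : ContDiffAt ℝ 2 v x)
    (hmax : IsLocalMax (fun y => v y + N / 2 * ‖y‖ ^ 2) x) (ξ : E n) :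
    fderiv ℝ (fderiv ℝ v) x ξ ξ ≤ -N * ‖ξ‖ ^ 2 := by
  have hv : ContDiffAt ℝ (2 : ℕ) v x := hv
  have h1 : ∀ᶠ y in 𝓝 x, HasFDerivAt v (fderiv ℝ v y) y := by
    filter_upwards [eventually_contDiffAt hv] with y hy
    exact (hy.differentiableAt (by simp)).hasFDerivAt
  have h2 : HasFDerivAt (fderiv ℝ v) (fderiv ℝ (fderiv ℝ v) x) x :=
    ((contDiffAt_fderiv (m := 1) hv le_rfl).differentiableAt (by simp)).hasFDerivAt
  refine le_of_forall_pos_le_add fun ε hε => ?_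
  have h3 := eventually_norm_second_difference_le h1 h2 ξ hε
  have lp : Filter.Tendsto (fun t : ℝ => x + t • ξ) (𝓝[>] 0) (𝓝 x) := by
    have : Continuous fun t : ℝ => x + t • ξ := by fun_prop
    simpa using (this.tendsto 0).mono_left nhdsWithin_le_nhds
  have lm : Filter.Tendsto (fun t : ℝ => x - t • ξ) (𝓝[>] 0) (𝓝 x) := by
    have : Continuous fun t : ℝ => x - t • ξ := by fun_prop
    simpa using (this.tendsto 0).mono_left nhdsWithin_le_nhds
  obtain ⟨t, ⟨h4, h5⟩, h6, h7⟩ := ((h3.and self_mem_nhdsWithin).and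
    ((lp.eventually hmax).and (lm.eventually hmax))).exists
  have ht : 0 < t := h5
  -- This makes the second difference of `N/2 * ‖y‖²` exactly `N t² ‖ξ‖²`.
  have hpar := parallelogram_law_with_norm ℝ x (t • ξ)
  rw [norm_smul, Real.norm_of_nonneg ht.le] at hpar
  rw [Real.norm_eq_abs, smul_eq_mul, smul_eq_mul] at h4
  have h8 := (abs_le.1 h4).1
  have h9 : t ^ 2 * (fderiv ℝ (fderiv ℝ v) x ξ ξ) ≤ t ^ 2 * (-N * ‖ξ‖ ^ 2 + ε) := by
    have : N / 2 * (‖x + t • ξ‖ ^ 2 + ‖x - t • ξ‖ ^ 2) =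
      N / 2 * (2 * (‖x‖ ^ 2 + (t * ‖ξ‖) ^ 2)) := by rw [hpar]
    nlinarith
  exact le_of_mul_le_mul_left h9 (by positivity)

end Hessian

/-! ### Exclusion of interior maxima and reduction to the boundary. -/

section MaximumPrinciple
open Matrix
variable {n : ℕ}

theorem quotientOperator_hessian {m : ℕ} {Ω : Set (E n)} {α : E n → ℝ} {a : ℕ → E n → ℝ}
    {u : E n → ℝ} (ha : ∀ l < m, ∀ x ∈ Ω, 0 ≤ a l x)
    (h : IsAdmissibleSolution (m + 1) Ω α a u) {x : E n} (hx : x ∈ Ω) :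
    quotientOperator m (hessian u x) (fun l => a l x ^ (1 / (((m + 1 : ℕ) : ℝ) - l))) = -α x := by
  have h1 := h.equation x hx
  have h2 : InGamma m (hessian u x) := h.admissible x hx
  have h3 := h2.sigma_pos le_rfl
  rw [Nat.add_sub_cancel] at h1
  have h4 : ∀ l ∈ Finset.range m, (a l x ^ (1 / (((m + 1 : ℕ) : ℝ) - l))) ^ (m + 1 - l) *
      (sigma l (hessian u x) / sigma m (hessian u x)) =
      a l x * sigma l (hessian u x) / sigma m (hessian u x) := by
    intro l hl
    have hl := Finset.mem_range.1 hl
    rw [← Nat.cast_sub (by omega), one_div, Real.rpow_inv_natCast_pow (ha l hl x hx) (by omega),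
      mul_div_assoc]
  rw [quotientOperator, Finset.sum_congr rfl h4, ← Finset.sum_div, ← h1]
  field_simp
  ring

theorem fderiv_fderiv_apply_apply {u : E n → ℝ} {x : E n} (hu : ContDiffAt ℝ 4 u x) (e ξ : E n) :
    fderiv ℝ (fderiv ℝ fun y => fderiv ℝ (fderiv ℝ u) y e e) x ξ ξ =
      fderiv ℝ (fderiv ℝ (fderiv ℝ (fderiv ℝ u))) x ξ ξ e e := by
  have hu : ContDiffAt ℝ (4 : ℕ) u x := hu
  have key : ∀ y, ContDiffAt ℝ (4 : ℕ) u y → ∀ ζ,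
      fderiv ℝ (fun y => fderiv ℝ (fderiv ℝ u) y e e) y ζ =
        fderiv ℝ (fderiv ℝ (fderiv ℝ u)) y ζ e e := by
    intro y hy ζ
    have h2 := contDiffAt_fderiv (m := 2) (contDiffAt_fderiv (m := 3) hy le_rfl) le_rfl
    have h3 : DifferentiableAt ℝ (fderiv ℝ (fderiv ℝ u)) y := h2.differentiableAt (by simp)
    rw [fderiv_clm_apply_const (Φ := fun y => fderiv ℝ (fderiv ℝ u) y e)
      (h3.clm_apply (differentiableAt_const e)), fderiv_clm_apply_const h3]
  have h2 := contDiffAt_fderiv (m := 2) (contDiffAt_fderiv (m := 3) hu le_rfl) le_rfl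
  have h3 : DifferentiableAt ℝ (fderiv ℝ (fderiv ℝ (fderiv ℝ u))) x :=
    (contDiffAt_fderiv (m := 1) h2 le_rfl).differentiableAt (by simp)
  have hv : ContDiffAt ℝ (2 : ℕ) (fun y => fderiv ℝ (fderiv ℝ u) y e e) x :=
    (h2.clm_apply contDiffAt_const).clm_apply contDiffAt_const
  have hv1 : DifferentiableAt ℝ (fderiv ℝ fun y => fderiv ℝ (fderiv ℝ u) y e e) x :=
    (contDiffAt_fderiv (m := 1) hv le_rfl).differentiableAt (by simp)
  rw [← fderiv_clm_apply_const hv1]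
  have hev : (fun y => fderiv ℝ (fun y => fderiv ℝ (fderiv ℝ u) y e e) y ξ) =ᶠ[𝓝 x]
      fun y => fderiv ℝ (fderiv ℝ (fderiv ℝ u)) y ξ e e := by
    filter_upwards [eventually_contDiffAt hu] with y hy using key y hy ξ
  have h4 : DifferentiableAt ℝ (fun y => fderiv ℝ (fderiv ℝ (fderiv ℝ u)) y ξ) x :=
    DifferentiableAt.clm_apply (c := fderiv ℝ (fderiv ℝ (fderiv ℝ u))) (u := fun _ => ξ) h3
      (differentiableAt_const ξ)
  rw [hev.fderiv_eq, fderiv_clm_apply_const (Φ := fun y => fderiv ℝ (fderiv ℝ (fderiv ℝ u)) y ξ e)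
    (h4.clm_apply (differentiableAt_const e)),
    fderiv_clm_apply_const (Φ := fun y => fderiv ℝ (fderiv ℝ (fderiv ℝ u)) y ξ) h4,
    fderiv_clm_apply_const h3]

/-- At an interior maximum of `D²u(e, e) + N |x|² / 2` the Hessian of `u` is strictly concave along
`e`, with `D⁴u(e, e, ξ, ξ) ≤ - N |ξ|²`; in discrete form. -/
theorem eventually_hessian_concave {u : E n → ℝ} {x e : E n} {N : ℝ} (hN : 0 < N)
    (hu : ContDiffAt ℝ 4 u x)
    (hmax : IsLocalMax (fun y => fderiv ℝ (fderiv ℝ u) y e e + N / 2 * ‖y‖ ^ 2) x) :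
    ∀ᶠ t in 𝓝[>] (0 : ℝ), ∀ ξ : Fin n → ℝ, N / 2 * t ^ 2 * (ξ ⬝ᵥ ξ) ≤
      ξ ⬝ᵥ ((2 : ℝ) • hessian u x - hessian u (x + t • e) - hessian u (x - t • e)) *ᵥ ξ := by
  have hu' : ContDiffAt ℝ (4 : ℕ) u x := hu
  have h2 := contDiffAt_fderiv (m := 2) (contDiffAt_fderiv (m := 3) hu' le_rfl) le_rfl
  have hv : ContDiffAt ℝ 2 (fun y => fderiv ℝ (fderiv ℝ u) y e e) x :=
    (h2.clm_apply contDiffAt_const).clm_apply contDiffAt_const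
  have d1 : ∀ᶠ y in 𝓝 x, HasFDerivAt (fderiv ℝ (fderiv ℝ u))
      (fderiv ℝ (fderiv ℝ (fderiv ℝ u)) y) y := by
    filter_upwards [eventually_contDiffAt h2] with y hy
    exact (hy.differentiableAt (by simp)).hasFDerivAt
  have d2 : HasFDerivAt (fderiv ℝ (fderiv ℝ (fderiv ℝ u)))
      (fderiv ℝ (fderiv ℝ (fderiv ℝ (fderiv ℝ u))) x) x :=
    ((contDiffAt_fderiv (m := 1) h2 le_rfl).differentiableAt (by simp)).hasFDerivAt
  -- The error `ε = N/2` consumes half of the concavity `N`, uniformly in `ξ`.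
  filter_upwards [eventually_norm_second_difference_le
    (Φ' := fderiv ℝ (fderiv ℝ (fderiv ℝ u)))
    (Φ'' := fderiv ℝ (fderiv ℝ (fderiv ℝ (fderiv ℝ u))) x) d1 d2 e (half_pos hN)] with t ht ξ
  set ζ : E n := WithLp.toLp 2 ξ
  have h3 := fderiv_fderiv_le_of_isLocalMax hv hmax ζ
  rw [fderiv_fderiv_apply_apply hu, ← fderiv_four_symm hu] at h3
  rw [sub_mulVec, sub_mulVec, smul_mulVec, dotProduct_sub, dotProduct_sub, dotProduct_smul,
    dotProduct_hessian_mulVec, dotProduct_hessian_mulVec, dotProduct_hessian_mulVec,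
    dotProduct_self_eq, smul_eq_mul]
  have h4 := (ContinuousLinearMap.le_opNorm₂ (fderiv ℝ (fderiv ℝ u) (x + t • e) +
    fderiv ℝ (fderiv ℝ u) (x - t • e) - (2 : ℝ) • fderiv ℝ (fderiv ℝ u) x -
    t ^ 2 • fderiv ℝ (fderiv ℝ (fderiv ℝ (fderiv ℝ u))) x e e) ζ ζ).trans
    (mul_le_mul_of_nonneg_right (mul_le_mul_of_nonneg_right ht (norm_nonneg ζ)) (norm_nonneg ζ))
  simp only [_root_.sub_apply, _root_.add_apply, _root_.smul_apply, smul_eq_mul,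
    Real.norm_eq_abs] at h4
  have h5 := (abs_le.1 h4).2
  have h6 := mul_le_mul_of_nonneg_left h3 (sq_nonneg t)
  linarith

/-- There is no interior maximum of `D²u(e, e) + N |x|² / 2` when `N` is large. -/
theorem not_isLocalMax_hessian {m : ℕ} (hm : m + 1 ≤ n) {Ω : Set (E n)} (hΩ : IsOpen Ω) {K : ℝ≥0}
    {α : E n → ℝ} {a : ℕ → E n → ℝ} {u : E n → ℝ} (hα : C11Bound Ω α K)
    (ha : ∀ l < m, ∀ x ∈ Ω, 0 ≤ a l x)
    (haK : ∀ l < m, C11Bound Ω (fun x => a l x ^ (1 / (((m + 1 : ℕ) : ℝ) - (l : ℝ)))) K)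
    (hu : ContDiffOn ℝ 4 u Ω) (h : IsAdmissibleSolution (m + 1) Ω α a u) {x e : E n} (hx : x ∈ Ω)
    (he : ‖e‖ = 1) {N : ℝ} (hN : N = 2 * (n * (2 * (m + 1) * K + 1))) :
    ¬ IsLocalMax (fun y => fderiv ℝ (fderiv ℝ u) y e e + N / 2 * ‖y‖ ^ 2) x := by
  intro hmax
  have hn : (0 : ℝ) < n := by exact_mod_cast (by omega : 0 < n)
  have hK : (0 : ℝ) ≤ K := K.2
  have hN0 : 0 < N := by rw [hN]; positivity
  have hu4 : ∀ y ∈ Ω, ContDiffAt ℝ 4 u y := fun y hy => hu.contDiffAt (hΩ.mem_nhds hy)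
  have hH : ∀ y ∈ Ω, (hessian u y).IsHermitian := fun y hy =>
    hessian_isHermitian ((hu4 y hy).of_le (by norm_num))
  obtain ⟨r, hr, hball⟩ := Metric.isOpen_iff.1 hΩ x hx
  obtain ⟨t, hQ, ht, htr⟩ := ((eventually_hessian_concave hN0 (hu4 x hx) hmax).and
    (Ioo_mem_nhdsGT hr)).exists
  have hp : x + t • e ∈ Ω := hball (by simpa [norm_smul, he, abs_of_pos ht] using htr)
  have hq : x - t • e ∈ Ω := hball (by
    simpa [dist_eq_norm, norm_smul, he, abs_of_pos ht] using htr)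
  set Q := (2 : ℝ) • hessian u x - hessian u (x + t • e) - hessian u (x - t • e) with hQdef
  have hQH : Q.IsHermitian := by
    have h2 : ((2 : ℝ) • hessian u x).IsHermitian := by
      rw [IsHermitian, conjTranspose_smul, (hH x hx).eq]; simp
    exact (h2.sub (hH _ hp)).sub (hH _ hq)
  -- `N` is tuned so that `ρ/n - mδ = (2K + 1)t²` for `ρ = (N/2)t²` and `δ = 2Kt²`, which exceeds
  -- the `2Kt²` available from `α`.
  have hρ : N / 2 * t ^ 2 / n = (2 * (m + 1) * K + 1) * t ^ 2 := by rw [hN]; field_simp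
  have hδρ : 2 * K * t ^ 2 ≤ N / 2 * t ^ 2 / n := by
    rw [hρ]
    refine mul_le_mul_of_nonneg_right ?_ (sq_nonneg t)
    have : (0 : ℝ) ≤ m * K := by positivity
    linarith
  obtain ⟨hQG, hQF⟩ := le_quotientOperator_of_posDef hQH (by positivity) hQ hm
    (δ := 2 * K * t ^ 2) (by positivity) hδρ
  set β : E n → ℕ → ℝ := fun y l => a l y ^ (1 / (((m + 1 : ℕ) : ℝ) - l)) with hβ
  have hβ0 : ∀ y ∈ Ω, ∀ l < m, 0 ≤ β y l := fun y hy l hl => Real.rpow_nonneg (ha l hl y hy) _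
  have hG : ∀ y ∈ Ω, InGamma m (hessian u y) := h.admissible
  have s1 := quotientOperator_superadditive (hH _ hp) (hH _ hq) (hG _ hp) (hG _ hq)
    (hβ0 _ hp) (hβ0 _ hq)
  have s2 := quotientOperator_superadditive ((hH _ hp).add (hH _ hq)) hQH
    (InGamma.superadditive (hH _ hp) (hH _ hq) (hG _ hp) (hG _ hq)).1 hQG
    (β := β (x + t • e) + β (x - t • e)) (γ := fun _ => 2 * K * t ^ 2)
    (fun l hl => add_nonneg (hβ0 _ hp l hl) (hβ0 _ hq l hl)) (fun l hl => by positivity)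
  have hsum : hessian u (x + t • e) + hessian u (x - t • e) + Q = (2 : ℝ) • hessian u x := by
    rw [hQdef]; abel
  -- The summand `δ` given to `Q` makes up for the second difference of `β`: `2β(x) ≤ β(x+te) +
  -- β(x-te) + δ`, so monotonicity returns to the equation at `x`.
  rw [hsum] at s2
  have s3 := quotientOperator_antitone (β := (2 : ℝ) • β x)
    (γ := β (x + t • e) + β (x - t • e) + fun _ => 2 * K * t ^ 2)
    ((hG x hx).smul (hH x hx) (c := 2) (by norm_num))
    (fun l hl => mul_nonneg (by norm_num) (hβ0 x hx l hl)) (fun l hl => by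
      have := (abs_le.1 ((haK l hl).abs_second_difference_le hΩ he hball ht.le htr)).1
      simp only [Pi.smul_apply, Pi.add_apply, smul_eq_mul, hβ]
      linarith)
  rw [quotientOperator_smul (hH x hx) m _ (by norm_num), quotientOperator_hessian ha h hx] at s3
  rw [quotientOperator_hessian ha h hp, quotientOperator_hessian ha h hq] at s1
  have s4 := (abs_le.1 (hα.abs_second_difference_le hΩ he hball ht.le htr)).2
  rw [hρ] at hQF
  have ht2 : 0 < t ^ 2 := by positivity
  linarith

theorem dotProduct_mulVec_le (A : Matrix (Fin n) (Fin n) ℝ) (ξ : Fin n → ℝ) :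
    ξ ⬝ᵥ A *ᵥ ξ ≤ matrixNorm A * (ξ ⬝ᵥ ξ) := by
  have h1 : ξ ⬝ᵥ A *ᵥ ξ = ∑ p : Fin n × Fin n, A p.1 p.2 * (ξ p.1 * ξ p.2) := by
    rw [Fintype.sum_prod_type]
    simp only [dotProduct, mulVec, Finset.mul_sum]
    exact Finset.sum_congr rfl fun i _ => Finset.sum_congr rfl fun j _ => by ring
  have h2 : (∑ p : Fin n × Fin n, (ξ p.1 * ξ p.2) ^ 2) = (ξ ⬝ᵥ ξ) ^ 2 := by
    rw [Fintype.sum_prod_type, sq, dotProduct, Finset.sum_mul_sum]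
    exact Finset.sum_congr rfl fun i _ => Finset.sum_congr rfl fun j _ => by ring
  have h3 : 0 ≤ ξ ⬝ᵥ ξ := Finset.sum_nonneg fun i _ => mul_self_nonneg _
  rw [h1]
  refine (Real.sum_mul_le_sqrt_mul_sqrt _ _ _).trans (le_of_eq ?_)
  rw [h2, Real.sqrt_sq h3, matrixNorm, Fintype.sum_prod_type]

/-- Nonnegative trace turns the upper bound on diagonal entries into a lower bound for their partial
sums; testing with `eᵢ ± eⱼ` then controls the off-diagonal entries. -/
theorem matrixNorm_le {A : Matrix (Fin n) (Fin n) ℝ} (hA : A.IsHermitian) (htr : 0 ≤ A.trace)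
    {L : ℝ} (h : ∀ ξ : Fin n → ℝ, ξ ⬝ᵥ A *ᵥ ξ ≤ L * (ξ ⬝ᵥ ξ)) : matrixNorm A ≤ n ^ 2 * L := by
  have hd : ∀ i, A i i ≤ L := by
    intro i
    have := h (Pi.single i 1)
    simpa using this
  have hsymm : ∀ i j, A j i = A i j := fun i j => by simpa using hA.apply i j
  rcases Nat.eq_zero_or_pos n with rfl | hn
  · simp [matrixNorm]
  have hL : 0 ≤ L := by
    have h1 : A.trace ≤ ∑ _i : Fin n, L := Finset.sum_le_sum fun i _ => hd i
    simp only [Finset.sum_const, Finset.card_univ, Fintype.card_fin, nsmul_eq_mul] at h1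
    by_contra! hc
    have : (0 : ℝ) < n := by exact_mod_cast hn
    nlinarith
  have hn1 : (1 : ℝ) ≤ n := by exact_mod_cast hn
  have hdl : ∀ s : Finset (Fin n), - ((n : ℝ) - s.card) * L ≤
      ∑ i ∈ s, A i i := by
    intro s
    have h1 : A.trace = ∑ i ∈ s, A i i + ∑ i ∈ sᶜ, A i i := (Finset.sum_add_sum_compl s _).symm
    have h2 : ∑ i ∈ sᶜ, A i i ≤ ∑ _i ∈ sᶜ, L := Finset.sum_le_sum fun i _ => hd i
    rw [Finset.sum_const, Finset.card_compl, Fintype.card_fin, nsmul_eq_mul,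
      Nat.cast_sub (by simpa using s.card_le_univ)] at h2
    linarith
  have hent : ∀ i j, |A i j| ≤ n * L := by
    intro i j
    rcases eq_or_ne i j with rfl | hij
    · have h1 := hdl {i}
      simp only [Finset.card_singleton, Finset.sum_singleton] at h1
      have h2 := hd i
      push_cast at h1
      rw [abs_le]
      constructor <;> nlinarith
    · have h1 := hdl {i, j}
      rw [Finset.card_pair hij, Finset.sum_pair hij] at h1
      push_cast at h1
      have h2 := h (Pi.single i 1 + Pi.single j 1)
      have h3 := h (Pi.single i 1 - Pi.single j 1)
      simp [mulVec_add, mulVec_sub, dotProduct_add, dotProduct_sub, add_dotProduct,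
        sub_dotProduct, hij, hij.symm, hsymm i j] at h2 h3
      rw [abs_le]
      constructor <;> nlinarith
  have hsq : ∑ i, ∑ j, A i j ^ 2 ≤ (n ^ 2 * L) ^ 2 := by
    have h1 : ∑ i, ∑ j, A i j ^ 2 ≤ ∑ _i : Fin n, ∑ _j : Fin n, (n * L) ^ 2 :=
      Finset.sum_le_sum fun i _ => Finset.sum_le_sum fun j _ => by
        rw [← sq_abs]; exact pow_le_pow_left₀ (abs_nonneg _) (hent i j) 2
    simp only [Finset.sum_const, Finset.card_univ, Fintype.card_fin, nsmul_eq_mul] at h1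
    calc _ ≤ _ := h1
      _ = _ := by ring
  exact (Real.sqrt_le_sqrt hsq).trans (le_of_eq (Real.sqrt_sq (by positivity)))

theorem InGamma.trace_pos {A : Matrix (Fin n) (Fin n) ℝ} (hA : A.IsHermitian) {m : ℕ} (hm : 1 ≤ m)
    (h : InGamma m A) : 0 < A.trace := by
  have h1 := h 1 le_rfl hm
  rw [sigma_eq_esym hA, esym_one] at h1
  simpa [hA.trace_eq_sum_eigenvalues] using h1

/-- Bound of the second derivatives in `Ω` by those on the boundary. -/
theorem fderiv_fderiv_le_of_boundary {Ω : Set (E n)} (hΩ : IsOpen Ω) {R : ℝ}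
    (hR : Ω ⊆ Metric.closedBall 0 R) {N : ℝ} (hN : 0 ≤ N) {u : E n → ℝ}
    {H : E n → Matrix (Fin n) (Fin n) ℝ} (hc : ContinuousOn H (closure Ω))
    (hH : Set.EqOn H (hessian u) Ω) {M : ℝ} (hM : ∀ x ∈ frontier Ω, matrixNorm (H x) ≤ M) {e : E n}
    (he : ‖e‖ = 1) (hint : ∀ x ∈ Ω,
      ¬ IsLocalMax (fun y => fderiv ℝ (fderiv ℝ u) y e e + N / 2 * ‖y‖ ^ 2) x)
    {x : E n} (hx : x ∈ Ω) : fderiv ℝ (fderiv ℝ u) x e e ≤ M + N / 2 * R ^ 2 := by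
  have hcl : closure Ω ⊆ Metric.closedBall 0 R := closure_minimal hR Metric.isClosed_closedBall
  have hcomp : IsCompact (closure Ω) :=
    (isCompact_closedBall (0 : E n) R).of_isClosed_subset isClosed_closure hcl
  have hval : ∀ y ∈ Ω, fderiv ℝ (fderiv ℝ u) y e e = e.ofLp ⬝ᵥ H y *ᵥ e.ofLp := fun y hy => by
    rw [hH hy, dotProduct_hessian_mulVec]
  have hcont : ContinuousOn (fun y => e.ofLp ⬝ᵥ H y *ᵥ e.ofLp + N / 2 * ‖y‖ ^ 2) (closure Ω) := by
    have hent : ∀ i j, ContinuousOn (fun y => H y i j) (closure Ω) := fun i j =>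
      (continuous_apply_apply i j).comp_continuousOn hc
    refine ContinuousOn.add ?_ (by fun_prop)
    simp only [dotProduct, mulVec]
    exact continuousOn_finsetSum _ fun i _ => continuousOn_const.mul
      (continuousOn_finsetSum _ fun j _ => (hent i j).mul continuousOn_const)
  -- The maximum is taken for the continuous extension `H`, because `hessian u` itself carries no
  -- information on the boundary.
  obtain ⟨z, hz, hmax⟩ := hcomp.exists_isMaxOn ⟨x, subset_closure hx⟩ hcont
  have hzΩ : z ∉ Ω := by
    intro hzΩ
    refine hint z hzΩ ?_
    filter_upwards [hΩ.mem_nhds hzΩ] with y hy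
    have : e.ofLp ⬝ᵥ H y *ᵥ e.ofLp + N / 2 * ‖y‖ ^ 2 ≤
        e.ofLp ⬝ᵥ H z *ᵥ e.ofLp + N / 2 * ‖z‖ ^ 2 := hmax (subset_closure hy)
    simpa only [hval y hy, hval z hzΩ] using this
  have hzf : z ∈ frontier Ω := by rw [hΩ.frontier_eq]; exact ⟨hz, hzΩ⟩
  have h1 : e.ofLp ⬝ᵥ H x *ᵥ e.ofLp + N / 2 * ‖x‖ ^ 2 ≤ e.ofLp ⬝ᵥ H z *ᵥ e.ofLp + N / 2 * ‖z‖ ^ 2 :=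
    hmax (subset_closure hx)
  have h2 := dotProduct_mulVec_le (H z) e.ofLp
  rw [dotProduct_self_eq] at h2
  have h3 : ‖WithLp.toLp 2 e.ofLp‖ = 1 := he
  rw [h3, one_pow, mul_one] at h2
  have h4 : ‖z‖ ≤ R := by simpa using hcl hz
  have h5 : N / 2 * ‖z‖ ^ 2 ≤ N / 2 * R ^ 2 := by gcongr
  have h6 : 0 ≤ N / 2 * ‖x‖ ^ 2 := by positivity
  rw [hval x hx]
  linarith [hM z hzf]

end MaximumPrinciple

end HessianEquation

/-! ### The global second derivative estimate. -/

open HessianEquation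
theorem theorem1p2 (n k : ℕ) (hk : 2 ≤ k) (hkn : k ≤ n)
    (Ω : Set (E n)) (hΩ : IsSmoothBoundedDomain Ω) (K : ℝ≥0) :
    ∃ C : ℝ≥0, ∀ (α : E n → ℝ) (a : ℕ → E n → ℝ) (u : E n → ℝ),
      C11Bound Ω α K →
      (∀ l < k - 1, ∀ x ∈ Ω, 0 ≤ a l x) →
      (∀ l < k - 1, C11Bound Ω (fun x => a l x ^ (1 / ((k : ℝ) - (l : ℝ)))) K) →
      ContDiffOn ℝ 4 u Ω →
      IsC2Closure Ω u →
      IsAdmissibleSolution k Ω α a u →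
      (⨆ x ∈ Ω, ENNReal.ofReal (matrixNorm (hessian u x))) ≤
        C * (1 + ⨆ x ∈ frontier Ω, ENNReal.ofReal (matrixNorm (closureHessian Ω u x))) := by
  obtain ⟨m, rfl⟩ : ∃ m, k = m + 1 := ⟨k - 1, by omega⟩
  simp only [Nat.add_sub_cancel]
  obtain ⟨R, hR⟩ := hΩ.isBounded.subset_closedBall 0
  set N : ℝ := 2 * (n * (2 * (m + 1) * K + 1)) with hN
  have hN0 : 0 ≤ N := by positivity
  have hn : (1 : ℝ) ≤ n := by exact_mod_cast (by omega : 1 ≤ n)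
  -- The factor `n ^ 2` comes from `matrixNorm_le`; the other absorbs the additive error, as `S + P
  -- ≤ (1 + P)(1 + S)` for `P, S ≥ 0`.
  set c : ℝ := n ^ 2 * (1 + N / 2 * R ^ 2) with hc
  have hc0 : 0 < c := by positivity
  refine ⟨c.toNNReal, fun α a u hα ha haK hu hcl hsol => ?_⟩
  obtain ⟨H, hHc, hHe⟩ := hcl.hessian
  set S := ⨆ x ∈ frontier Ω, ENNReal.ofReal (matrixNorm (closureHessian Ω u x)) with hS
  rcases eq_or_ne S ⊤ with htop | htop
  · rw [htop, add_top, ENNReal.mul_top (by simpa using hc0)]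
    exact le_top
  have hM : ∀ x ∈ frontier Ω, matrixNorm (H x) ≤ S.toReal := by
    intro x hx
    have h1 : ENNReal.ofReal (matrixNorm (closureHessian Ω u x)) ≤ S := by
      rw [hS]; exact le_iSup₂_of_le x hx le_rfl
    rw [closureHessian_eq hHc hHe (frontier_subset_closure hx)] at h1
    exact (ENNReal.ofReal_le_iff_le_toReal htop).1 h1
  have hint : ∀ e : E n, ‖e‖ = 1 → ∀ x ∈ Ω,
      ¬ IsLocalMax (fun y => fderiv ℝ (fderiv ℝ u) y e e + N / 2 * ‖y‖ ^ 2) x := fun e he x hx =>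
    not_isLocalMax_hessian hkn hΩ.isOpen hα ha haK hu hsol hx he hN
  refine iSup₂_le fun x hx => ?_
  have hA : (hessian u x).IsHermitian := hessian_isHermitian
    ((hu.contDiffAt (hΩ.isOpen.mem_nhds hx)).of_le (by norm_num))
  have hquad : ∀ ξ : Fin n → ℝ, ξ ⬝ᵥ Matrix.mulVec (hessian u x) ξ ≤
      (S.toReal + N / 2 * R ^ 2) * (ξ ⬝ᵥ ξ) := by
    intro ξ
    rw [dotProduct_hessian_mulVec, dotProduct_self_eq]
    set ζ : E n := WithLp.toLp 2 ξ
    rcases eq_or_ne ζ 0 with h0 | h0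
    · simp [h0]
    have hζ : 0 < ‖ζ‖ := norm_pos_iff.2 h0
    have h1 : ‖‖ζ‖⁻¹ • ζ‖ = 1 := by rw [norm_smul, norm_inv, norm_norm, inv_mul_cancel₀ hζ.ne']
    have h2 := fderiv_fderiv_le_of_boundary hΩ.isOpen hR hN0 hHc hHe hM h1 (hint _ h1) hx
    simp only [map_smul, _root_.smul_apply, smul_eq_mul] at h2
    calc _ = ‖ζ‖⁻¹ * (‖ζ‖⁻¹ * fderiv ℝ (fderiv ℝ u) x ζ ζ) * ‖ζ‖ ^ 2 := by field_simp
      _ ≤ _ := mul_le_mul_of_nonneg_right h2 (sq_nonneg _)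
  have hadm : InGamma m (hessian u x) := hsol.admissible x hx
  have hfin := matrixNorm_le hA (hadm.trace_pos hA (by omega)).le hquad
  have hS0 : 0 ≤ S.toReal := ENNReal.toReal_nonneg
  have hle : matrixNorm (hessian u x) ≤ c * (1 + S.toReal) := by
    refine hfin.trans ?_
    rw [hc, mul_assoc]
    refine mul_le_mul_of_nonneg_left ?_ (by positivity)
    have : 0 ≤ N / 2 * R ^ 2 := by positivity
    nlinarith [mul_nonneg this hS0]
  calc ENNReal.ofReal (matrixNorm (hessian u x)) ≤ ENNReal.ofReal (c * (1 + S.toReal)) :=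
        ENNReal.ofReal_le_ofReal hle
    _ = c.toNNReal * (1 + S) := by
        rw [ENNReal.ofReal_mul hc0.le, ENNReal.ofReal_add zero_le_one hS0, ENNReal.ofReal_one,
          ENNReal.ofReal_toReal htop]
        rfl
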